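/- All logarithms are to base 2. A *nondeterministic branching program* (NBP) $Z$ is a finite directed acyclic multigraph with one source and one sink in which some edges are labelled with literals; its size $|Z|$ is the number of its vertices. A *computational path* is a source-sink path on which no two opposite literals of one variable occur. $Z$ computes a Boolean function $F$ if an assignment satisfies $F$ exactly when it makes all literals on some computational path true. $Z$ is a (syntactic) *read-$d$-times* NBP ($d$-NBP) if each variable occurs at most $d$ times on each source-sink path. For a natural number $m$ let $2^h$ be the least power of two with $h\ge 0$ and $2^h\ge m^{1/4.9}$, and let $T'$ be the complete binary tree with $2^h$ leaves. For a set $L$ of $\lfloor m^{1/4.9}\rfloor$ leaves of $T'$ let $T^*_1,\dots,T^*_m$ be disjoint copies of the union of the root-leaf paths of $T'$ that end in $L$. The graph $G_m=G_m(L)$ consists of $T^*_1,\dots,T^*_m$ and, for all $1\le i<j\le m$, each leaf $\ell_1$ of $T^*_i$ and each leaf $\ell_2$ of $T^*_j$, one new *subdivision vertex* $v$ adjacent to $\ell_1$ and $\ell_2$. The variables of the CNF $\varphi(G_m)$ are the vertices of $G_m$, and for every subdivision vertex $v$, adjacent to $\ell_1$ and $\ell_2$ as above, it has the clause whose literals are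 the (positive) vertices of the root-leaf path of $T^*_i$ ending at $\ell_1$, the vertex $v$, and the vertices of the root-leaf path of $T^*_j$ ending at $\ell_2$. Let $n$ be the number of variables of $\varphi(G_m)$. **Theorem.** (1) The sets $L=L_m$ can be chosen such that a deterministic Turing machine, given $m$ in unary, writes down $\varphi(G_m)$ (with its variables named by natural numbers) in time polynomial in $m$. (2) For every $m$ and every choice of $L$, $\varphi(G_m)$ is a monotone CNF with at most $n$ clauses, and $n\ge m$. (3) There are constants $\alpha>1$ and $0<\beta<1$ such that for all sufficiently large $m$ and every choice of $L$, every $d$-NBP $Z$ with $d\le \log n/10^5$ that computes $\varphi(G_m)$ satisfies $|Z|\ge \alpha^{n^{\beta}}$. -/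

import Mathlib

/-! ### CNFs -/

/-- A literal: the variable `l.1`, positive if `l.2 = true` and negated if `l.2 = false`. -/
abbrev Literal (V : Type) : Type := V × Bool

/-- A CNF over the variable set `V`: a finite set of clauses, a clause being a finite set of
literals. -/
abbrev CNF (V : Type) : Type := Finset (Finset (Literal V))

namespace CNF

/-- All literals are positive. -/
def IsMonotone {V : Type} (φ : CNF V) : Prop := ∀ C ∈ φ, ∀ l ∈ C, l.2 = true

/-- The truth assignment `a` satisfies `φ`. -/
def Sat {V : Type} (φ : CNF V) (a : V → Bool) : Prop := ∀ C ∈ φ, ∃ l ∈ C, a l.1 = l.2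

/-- Renaming of the variables. -/
def rename {V W : Type} [DecidableEq W] (e : V → W) (φ : CNF V) : CNF W :=
  φ.image fun C => C.image fun l => (e l.1, l.2)

end CNF

/-! ### Nondeterministic branching programs -/

/-- A nondeterministic branching program with literals over `V`: a finite directed acyclic
multigraph with exactly one source and exactly one sink, some of whose edges are labelled with
literals. -/
structure NBP (V : Type) where
  Vertex : Type
  Edge : Type
  [vertexFintype : Fintype Vertex]
  [edgeFintype : Fintype Edge]
  /-- the tail of an edge -/
  src : Edge → Vertex
  /-- the head of an edge -/
  tgt : Edge → Vertex
  /-- `none` for an unlabelled edge -/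
  label : Edge → Option (Literal V)
  source : Vertex
  sink : Vertex
  acyclic : ∀ v, ¬ Relation.TransGen (fun u w => ∃ e, src e = u ∧ tgt e = w) v v
  source_unique : ∀ v, (∀ e, tgt e ≠ v) ↔ v = source
  sink_unique : ∀ v, (∀ e, src e ≠ v) ↔ v = sink

namespace NBP

variable {V : Type}

/-- The size: the number of vertices. -/
def size (Z : NBP V) : ℕ := @Fintype.card Z.Vertex Z.vertexFintype

/-- The list of edges `P` is a directed path from `u` to `w`. -/
def IsPath (Z : NBP V) : Z.Vertex → List Z.Edge → Z.Vertex → Prop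
  | u, [], w => u = w
  | u, e :: P, w => Z.src e = u ∧ IsPath Z (Z.tgt e) P w

/-- The sequence of literals along a list of edges. -/
def labels (Z : NBP V) (P : List Z.Edge) : List (Literal V) := P.filterMap Z.label

/-- A computational path: a source-sink path without opposite literals of one variable. -/
def IsComputational (Z : NBP V) (P : List Z.Edge) : Prop :=
  Z.IsPath Z.source P Z.sink ∧ ∀ x, ¬ ((x, true) ∈ Z.labels P ∧ (x, false) ∈ Z.labels P)

/-- `Z` accepts the assignment `a`: some computational path carries only literals true
under `a`. -/
def Accepts (Z : NBP V) (a : V → Bool) : Prop :=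
  ∃ P, Z.IsComputational P ∧ ∀ l ∈ Z.labels P, a l.1 = l.2

/-- `Z` computes `φ` as a function on assignments to `V`. -/
def Computes (Z : NBP V) (φ : CNF V) : Prop := ∀ a, Z.Accepts a ↔ φ.Sat a

/-- Syntactic read-`d`-times: on each source-sink path (computational or not) each variable
occurs at most `d` times. -/
def IsReadTimes [DecidableEq V] (Z : NBP V) (d : ℕ) : Prop :=
  ∀ P, Z.IsPath Z.source P Z.sink → ∀ x, ((Z.labels P).map Prod.fst).count x ≤ d

end NBP

/-! ### The graphs `G_m` and the formulas `φ(G_m)`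

The nodes of the complete binary tree with `2 ^ h` leaves are the bit strings of length at
most `h`; the empty string is the root, the strings of length `h` are the leaves, and the
root-leaf path ending at `ℓ` consists of the prefixes of `ℓ`. -/

/-- The number of leaves of each tree, `⌊m^(1/4.9)⌋`. -/
noncomputable def numLeaves (m : ℕ) : ℕ := ⌊(m : ℝ) ^ (1 / 4.9 : ℝ)⌋₊

/-- The least `h` with `2 ^ h ≥ m^(1/4.9)`. -/
noncomputable def treeDepth (m : ℕ) : ℕ := Nat.clog 2 ⌈(m : ℝ) ^ (1 / 4.9 : ℝ)⌉₊

/-- `L` is a set of `numLeaves m` leaves of the complete binary tree of depth `treeDepth m`. -/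
def IsLeafChoice (m : ℕ) (L : Finset (List Bool)) : Prop :=
  (∀ ℓ ∈ L, ℓ.length = treeDepth m) ∧ L.card = numLeaves m

/-- The nodes of the union of the root-leaf paths that end at the leaves in `L`. -/
abbrev TreeNode (L : Finset (List Bool)) : Type :=
  {x : List Bool // x ∈ L.biUnion fun ℓ => ℓ.inits.toFinset}

/-- The subdivision vertices: one for every two distinct trees `i < j`, leaf of tree `i` and leaf
of tree `j`. -/
abbrev SubdivVertex (m : ℕ) (L : Finset (List Bool)) : Type :=
  {p : Fin m × Fin m // p.1 < p.2} × L × L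

/-- The vertices of `G_m`: the nodes of `m` disjoint copies of the tree, and the subdivision
vertices. -/
abbrev GVertex (m : ℕ) (L : Finset (List Bool)) : Type :=
  (Fin m × TreeNode L) ⊕ SubdivVertex m L

instance instDecidableEqGVertex (m : ℕ) (L : Finset (List Bool)) : DecidableEq (GVertex m L) :=
  inferInstance

/-- The vertices of the root-leaf path of the tree `i` that ends at `ℓ`. -/
def rootLeafPath {m : ℕ} {L : Finset (List Bool)} (i : Fin m) (ℓ : L) : Finset (GVertex m L) :=
  (Finset.univ.filter fun x : TreeNode L => x.1 <+: ℓ.1).image fun x => Sum.inl (i, x)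

/-- The variables of the clause `C_v`. -/
def clauseVars {m : ℕ} {L : Finset (List Bool)} (v : SubdivVertex m L) : Finset (GVertex m L) :=
  rootLeafPath v.1.1.1 v.2.1 ∪ {Sum.inr v} ∪ rootLeafPath v.1.1.2 v.2.2

/-- The formula `φ(G_m)`. -/
def phiG (m : ℕ) (L : Finset (List Bool)) : CNF (GVertex m L) :=
  Finset.univ.image fun v : SubdivVertex m L => (clauseVars v).image fun x => (x, true)

/-! ### Writing down a CNF in polynomial time -/

/-- The alphabet in which CNFs are written: variables are natural numbers in unary. -/
inductive CNFSymbol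
  | tick
  | endLiteral (positive : Bool)
  | endClause

/-- A CNF as it is written down: a list of lists of literals over the variables `0, 1, 2, …`. -/
abbrev CNFList : Type := List (List (ℕ × Bool))

namespace CNFList

/-- The string that represents a literal. -/
def encodeLiteral (l : ℕ × Bool) : List CNFSymbol :=
  List.replicate l.1 CNFSymbol.tick ++ [CNFSymbol.endLiteral l.2]

/-- The string that represents a clause. -/
def encodeClause (C : List (ℕ × Bool)) : List CNFSymbol :=
  C.flatMap encodeLiteral ++ [CNFSymbol.endClause]

/-- The string that represents a list of clauses. -/
def encode (F : CNFList) : List CNFSymbol := F.flatMap encodeClause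

/-- The set of clauses that a list represents. -/
def toCNF (F : CNFList) : CNF ℕ := (F.map List.toFinset).toFinset

/-- One step of reading a string from right to left. -/
def readSymbol : CNFSymbol → CNFList → CNFList
  | .endClause, F => [] :: F
  | .endLiteral b, C :: F => ((0, b) :: C) :: F
  | .tick, ((x, b) :: C) :: F => ((x + 1, b) :: C) :: F
  | _, F => F

theorem foldr_encodeLiteral (l : ℕ × Bool) (C : List (ℕ × Bool)) (F : CNFList) :
    (encodeLiteral l).foldr readSymbol (C :: F) = (l :: C) :: F := by
  obtain ⟨x, b⟩ := l
  induction x with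
  | zero => rfl
  | succ x ih =>
    have h : encodeLiteral (x + 1, b) = CNFSymbol.tick :: encodeLiteral (x, b) := rfl
    rw [h, List.foldr_cons, ih]
    rfl

theorem foldr_encodeClause (C : List (ℕ × Bool)) (F : CNFList) :
    (encodeClause C).foldr readSymbol F = C :: F := by
  induction C with
  | nil => rfl
  | cons l C ih =>
    have h : encodeClause (l :: C) = encodeLiteral l ++ encodeClause C := by
      simp [encodeClause]
    rw [h, List.foldr_append, ih, foldr_encodeLiteral]

theorem foldr_encode (F : CNFList) : (encode F).foldr readSymbol [] = F := by
  induction F with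
  | nil => rfl
  | cons C F ih =>
    have h : encode (C :: F) = encodeClause C ++ encode F := rfl
    rw [h, List.foldr_append, ih, foldr_encodeClause]

/-- The representation of CNFs by strings is uniquely decodable. -/
def encoding : Computability.Encoding CNFList CNFSymbol where
  encode := encode
  decode s := some (s.foldr readSymbol [])
  decode_encode F := congrArg some (foldr_encode F)

end CNFList

/-- Some deterministic Turing machine (with several stacks over finite alphabets), given `m` in
unary, writes down `f m` within a number of steps that is polynomial in `m`. -/
def PolyTimeProduced (f : ℕ → CNFList) : Prop :=
  ∃ M : Turing.TM2ComputableInPolyTime Computability.unaryEncodingNat.encode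
      CNFList.encoding.encode f,
    ∀ k, Finite (M.tm.Γ k)

/-! ### Counter programs -/

/-! The lower bound is a rectangle argument in which only the roots of the trees matter. Take `k`
left trees, with `k` about `m^(1/4)`, and `q = m / 2` right trees. An injection `π` of the left
trees into the right ones and a ternary word `x` give an assignment: the subdivision vertices
between matched trees are false and the others true, all proper descendants of roots are false, and
in the pair of `u` the left root is false if `x u = 0`, the right root is false if `x u = 1`, and
both are true if `x u = 2`. It satisfies the formula, but making both roots of one pair false does
not (`phiGMatchingFamily`).

Cut an accepting path greedily into at most `4 d ^ 2 + 1` segments, each meeting at most `B = q / (2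
d)` right roots (`NBP.exists_chain`). A segment records only its two end vertices, or a single
labelled edge, so the number of such chains is at most a power of `|Z|^2 (2 n + 2) + 1` with
exponent `4 d ^ 2 + 1`.

Fix a chain. Because reading is syntactic, each variable lies on at most `d` of its segments
(`IsChain.countP_le`). A uniformly random set `A` of segments contains all segments of a left root
and none of a right root with probability at least `4^(-d)` whenever the two roots share no segment,
and by the choice of `B` at least half of the right roots share none with a given left root. So some
`A` separates a fraction `1 / (2 * 4 ^ d)` of all pairs (`exists_separating_finset`). If `x` and
`x'` both satisfy the chain and differ only on separated pairs of `π`, then following `x` on `A` and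
`x'` elsewhere is again accepted; hence `x u = 0`, `x' u = 1` is impossible, and each separated pair
reduces the three choices to two (`card_le_of_avoids`). On average over `π`, a chain therefore
covers at most a fraction of about `exp (-k / (6 * 4 ^ d))` of the pairs `(π, x)`. All pairs are
covered, so there are many chains and `|Z|` is large.

For the uniformity statement, programs with unary counters are compiled to stack machines;
polynomial-time functions and outputs are closed under a few operations (`Comp`, `Emits`), and the
rounded powers `m^(1/4.9)` are found by comparing `x ^ 49` with `m ^ 10`. -/

/-- Programs that operate on unary counters and write symbols on an output stack. -/
inductive CounterProg
  | inc (r : ℕ)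
  | dec (r : ℕ)
  | emit (s : CNFSymbol)
  | seq (c₁ c₂ : CounterProg)
  /-- repeat `c` as long as the counter `r` is not zero -/
  | loop (r : ℕ) (c : CounterProg)

namespace CounterProg

open Function

/-- `Exec c σ o t σ' o'`: started with counters `σ` and output `o`, the program `c` halts after
`t` steps with counters `σ'` and output `o'`. -/
inductive Exec : CounterProg → (ℕ → ℕ) → List CNFSymbol → ℕ → (ℕ → ℕ) → List CNFSymbol → Prop
  | inc (r σ o) : Exec (inc r) σ o 1 (update σ r (σ r + 1)) o
  | dec (r σ o) : Exec (dec r) σ o 1 (update σ r (σ r - 1)) o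
  | emit (s σ o) : Exec (emit s) σ o 1 σ (s :: o)
  | seq {c₁ c₂ σ o t₁ σ₁ o₁ t₂ σ₂ o₂} : Exec c₁ σ o t₁ σ₁ o₁ → Exec c₂ σ₁ o₁ t₂ σ₂ o₂ →
      Exec (seq c₁ c₂) σ o (t₁ + t₂) σ₂ o₂
  | loop_zero {r c σ o} : σ r = 0 → Exec (loop r c) σ o 1 σ o
  | loop_succ {r c σ o t₁ σ₁ o₁ t₂ σ₂ o₂} : σ r ≠ 0 → Exec c σ o t₁ σ₁ o₁ →
      Exec (loop r c) σ₁ o₁ t₂ σ₂ o₂ → Exec (loop r c) σ o (1 + t₁ + t₂) σ₂ o₂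

/-! #### Compilation to stack machines -/

/-- All counters that occur are at most `N`. -/
def RegsLe (N : ℕ) : CounterProg → Prop
  | inc r => r ≤ N
  | dec r => r ≤ N
  | emit _ => True
  | seq c₁ c₂ => RegsLe N c₁ ∧ RegsLe N c₂
  | loop r c => r ≤ N ∧ RegsLe N c

theorem RegsLe.mono {N N' : ℕ} (h : N ≤ N') : ∀ {c : CounterProg}, RegsLe N c → RegsLe N' c
  | inc _, hc => le_trans hc h
  | dec _, hc => le_trans hc h
  | emit _, _ => trivial
  | seq _ _, hc => ⟨RegsLe.mono h hc.1, RegsLe.mono h hc.2⟩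
  | loop _ _, hc => ⟨le_trans hc.1 h, RegsLe.mono h hc.2⟩

theorem exists_regsLe : ∀ c : CounterProg, ∃ N, RegsLe N c
  | inc r => ⟨r, le_refl _⟩
  | dec r => ⟨r, le_refl _⟩
  | emit _ => ⟨0, trivial⟩
  | seq c₁ c₂ =>
    have ⟨N₁, h₁⟩ := exists_regsLe c₁
    have ⟨N₂, h₂⟩ := exists_regsLe c₂
    ⟨max N₁ N₂, h₁.mono (le_max_left _ _), h₂.mono (le_max_right _ _)⟩
  | loop r c =>
    have ⟨N, h⟩ := exists_regsLe c
    ⟨max r N, le_max_left _ _, h.mono (le_max_right _ _)⟩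

/-- The positions in a program. -/
def Lab : CounterProg → Type
  | inc _ => Unit
  | dec _ => Unit
  | emit _ => Unit
  | seq c₁ c₂ => Lab c₁ ⊕ Lab c₂
  | loop _ c => Option (Lab c)

instance finite_lab : ∀ c : CounterProg, Finite (Lab c)
  | inc _ => inferInstanceAs (Finite Unit)
  | dec _ => inferInstanceAs (Finite Unit)
  | emit _ => inferInstanceAs (Finite Unit)
  | seq c₁ c₂ =>
    have := finite_lab c₁
    have := finite_lab c₂
    inferInstanceAs (Finite (Lab c₁ ⊕ Lab c₂))
  | loop _ c =>
    have := finite_lab c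
    inferInstanceAs (Finite (Option (Lab c)))

/-- The position at which a program starts. -/
def entry : ∀ c : CounterProg, Lab c
  | inc _ => ()
  | dec _ => ()
  | emit _ => ()
  | seq c₁ _ => Sum.inl (entry c₁)
  | loop _ _ => none

/-- The stack alphabets: `none` is the output stack, the other stacks hold counters. -/
abbrev StackAlphabet (N : ℕ) : Option (Fin (N + 1)) → Type
  | none => CNFSymbol
  | some _ => Bool

/-- The stack that holds the counter `r`. -/
abbrev reg (N r : ℕ) : Option (Fin (N + 1)) := some (Fin.ofNat (N + 1) r)

open Turing.TM2.Stmt in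
/-- The stack machine code for a program, with labels embedded by `emb` and continuing at the
label `dest`. -/
def compile (N : ℕ) {Λ : Type} : ∀ c : CounterProg, (Lab c → Λ) → Λ → Lab c →
    Turing.TM2.Stmt (StackAlphabet N) Λ Bool
  | inc r, _, dest, _ => push (reg N r) (fun _ => true) (goto fun _ => dest)
  | dec r, _, dest, _ => pop (reg N r) (fun v _ => v) (goto fun _ => dest)
  | emit s, _, dest, _ => push none (fun _ => s) (goto fun _ => dest)
  | seq c₁ c₂, emb, _, Sum.inl l =>
    compile N c₁ (fun l => emb (Sum.inl l)) (emb (Sum.inr (entry c₂))) l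
  | seq _ c₂, emb, dest, Sum.inr l => compile N c₂ (fun l => emb (Sum.inr l)) dest l
  | loop r c, emb, dest, none =>
    peek (reg N r) (fun _ o => o.isSome)
      (branch id (goto fun _ => emb (some (entry c))) (goto fun _ => dest))
  | loop _ c, emb, _, some l => compile N c (fun l => emb (some l)) (emb none) l

/-- The stacks that represent counters and an output. -/
def stackOf (N : ℕ) (σ : ℕ → ℕ) (o : List CNFSymbol) : ∀ k, List (StackAlphabet N k)
  | none => o
  | some i => List.replicate (σ i) true

theorem stackOf_reg {N r : ℕ} (h : r ≤ N) (σ : ℕ → ℕ) (o : List CNFSymbol) :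
    stackOf N σ o (reg N r) = List.replicate (σ r) true := by
  simp [stackOf, Fin.ofNat, Nat.mod_eq_of_lt (Nat.lt_succ_of_le h)]

theorem update_stackOf_reg {N r : ℕ} (h : r ≤ N) (σ : ℕ → ℕ) (o : List CNFSymbol) (x : ℕ) :
    update (stackOf N σ o) (reg N r) (List.replicate x true) = stackOf N (update σ r x) o := by
  funext k
  match k with
  | none => rfl
  | some i =>
    by_cases hi : i = Fin.ofNat (N + 1) r
    · subst hi
      change update (stackOf N σ o) (reg N r) _ (reg N r) = _
      rw [update_self, stackOf_reg h, update_self]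
    · have hi' : (i : ℕ) ≠ r := by
        rintro rfl
        exact hi (by simp)
      rw [update_of_ne (by simpa [reg] using hi)]
      simp [stackOf, update_of_ne hi']

theorem flip_bind_some {α : Type} (f : α → Option α) (x : α) : flip bind f (some x) = f x := rfl

/-- The cost model matches the machine exactly: sequencing is free, and every other instruction,
including a loop test, is one machine step. Only the labels in the image of `emb` are constrained,
so the induction applies to subprograms; the state after a test is unknown, hence the existential
`v'`. -/
theorem compile_correct {N : ℕ} {Λ : Type} {M : Λ → Turing.TM2.Stmt (StackAlphabet N) Λ Bool}
    {c : CounterProg} {σ : ℕ → ℕ} {o : List CNFSymbol} {t : ℕ} {σ' : ℕ → ℕ} {o' : List CNFSymbol}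
    (h : Exec c σ o t σ' o') : ∀ (_ : RegsLe N c) (emb : Lab c → Λ) (dest : Λ)
    (_ : ∀ l, M (emb l) = compile N c emb dest l) (v : Bool), ∃ v',
      (flip bind (Turing.TM2.step M))^[t] (some ⟨some (emb (entry c)), v, stackOf N σ o⟩) =
        some ⟨some dest, v', stackOf N σ' o'⟩ := by
  induction h with
  | inc r σ o =>
    intro hN emb dest hM v
    refine ⟨v, ?_⟩
    simp only [iterate_one]
    rw [flip_bind_some, Turing.TM2.step, hM]
    simp only [compile, Turing.TM2.stepAux]
    rw [stackOf_reg hN, ← List.replicate_succ, update_stackOf_reg hN]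
  | dec r σ o =>
    intro hN emb dest hM v
    refine ⟨v, ?_⟩
    simp only [iterate_one]
    rw [flip_bind_some, Turing.TM2.step, hM]
    simp only [compile, Turing.TM2.stepAux]
    rw [stackOf_reg hN, List.tail_replicate, update_stackOf_reg hN]
  | emit s σ o =>
    intro hN emb dest hM v
    refine ⟨v, ?_⟩
    simp only [iterate_one]
    rw [flip_bind_some, Turing.TM2.step, hM]
    simp only [compile, Turing.TM2.stepAux]
    congr 2
    funext k
    match k with
    | none => rfl
    | some i => rfl
  | @seq c₁ c₂ σ o t₁ σ₁ o₁ t₂ σ₂ o₂ _ _ ih₁ ih₂ =>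
    intro hN emb dest hM v
    obtain ⟨v₁, h₁⟩ := ih₁ hN.1 (fun l => emb (Sum.inl l)) (emb (Sum.inr (entry _)))
      (fun l => hM (Sum.inl l)) v
    obtain ⟨v₂, h₂⟩ := ih₂ hN.2 (fun l => emb (Sum.inr l)) dest (fun l => hM (Sum.inr l)) v₁
    refine ⟨v₂, ?_⟩
    rw [add_comm _ t₂, iterate_add_apply]
    exact (congrArg _ h₁).trans h₂
  | @loop_zero r c σ o h0 =>
    intro hN emb dest hM v
    -- Peeking at an empty stack leaves `false` in the internal state.
    refine ⟨false, ?_⟩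
    simp only [iterate_one]
    rw [flip_bind_some, Turing.TM2.step, hM]
    simp only [compile, Turing.TM2.stepAux, entry]
    rw [stackOf_reg hN.1, h0]
    rfl
  | @loop_succ r c σ o t₁ σ₁ o₁ t₂ σ₂ o₂ h0 _ _ ih₁ ih₂ =>
    intro hN emb dest hM v
    obtain ⟨v₁, h₁⟩ := ih₁ hN.2 (fun l => emb (some l)) (emb none)
      (fun l => hM (some l)) true
    obtain ⟨v₂, h₂⟩ := ih₂ hN emb dest hM v₁
    refine ⟨v₂, ?_⟩
    rw [show 1 + t₁ + t₂ = t₂ + (t₁ + 1) by omega, iterate_add_apply, iterate_add_apply,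
      iterate_one]
    have h2 : flip bind (Turing.TM2.step M) (some ⟨some (emb (entry (loop r c))), v, stackOf N σ o⟩)
        = some ⟨some (emb (some (entry c))), true, stackOf N σ o⟩ := by
      rw [flip_bind_some, Turing.TM2.step, hM]
      simp only [compile, Turing.TM2.stepAux, entry]
      obtain ⟨x, hx⟩ := Nat.exists_eq_succ_of_ne_zero h0
      rw [stackOf_reg hN.1, hx]
      rfl
    rw [h2]
    exact (congrArg _ h₁).trans h₂

end CounterProg

instance instFiniteCNFSymbol : Finite CNFSymbol :=
  Finite.of_injective (β := Option (Option Bool))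
    (fun | .tick => none | .endClause => some none | .endLiteral b => some (some b)) <| by
    rintro (_ | _ | _) (_ | _ | _) h <;> simp_all

/-! ### The stack machine of a counter program. -/

open CounterProg in
/-- The stack machine that runs a counter program and stops. -/
noncomputable def CounterProg.machine (N : ℕ) (c : CounterProg) : Turing.FinTM2 where
  K := Option (Fin (N + 1))
  k₀ := some 0
  k₁ := none
  Γ := StackAlphabet N
  Λ := Option (Lab c)
  main := some (entry c)
  ΛFin := @Fintype.ofFinite _ (have := finite_lab c; inferInstance)
  σ := Bool
  initialState := false
  Γk₀Fin := inferInstanceAs (Fintype Bool)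
  m
    | none => Turing.TM2.Stmt.load (fun _ => false) Turing.TM2.Stmt.halt
    | some l => compile N c some none l

open CounterProg in
-- A halting configuration must have all stacks except the output empty and the initial internal
-- state. The former is why the final counters are `0`; the latter costs the one additional step at
-- the label `none`.
theorem polyTimeProduced_of_exec {f : ℕ → CNFList} (c : CounterProg) (P : Polynomial ℕ)
    (h : ∀ m, ∃ t ≤ P.eval m, Exec c (Function.update 0 0 m) [] t 0 (CNFList.encode (f m))) :
    PolyTimeProduced f := by
  obtain ⟨N, hN⟩ := exists_regsLe c
  have key : ∀ m, ∃ t ≤ P.eval m, (flip bind (machine N c).step)^[t + 1]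
      (some (Turing.initList (machine N c) (Computability.unaryEncodingNat.encode m))) =
        some (Turing.haltList (machine N c) (CNFList.encode (f m))) := by
    intro m
    obtain ⟨t, ht, he⟩ := h m
    obtain ⟨v, hv⟩ := compile_correct (M := (machine N c).m) he hN some none (fun l => rfl) false
    refine ⟨t, ht, ?_⟩
    rw [Function.iterate_succ_apply']
    have h1 : Turing.initList (machine N c) (Computability.unaryEncodingNat.encode m) =
        ⟨some (some (entry c)), false, stackOf N (Function.update 0 0 m) []⟩ := by
      have hm : ∀ m, Computability.unaryEncodeNat m = List.replicate m true := by
        intro m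
        induction m with
        | zero => rfl
        | succ m ih => rw [Computability.unaryEncodeNat, ih, List.replicate_succ]
      unfold Turing.initList
      congr 1
      funext k
      match k with
      | none => rfl
      | some i =>
        by_cases hi : i = 0
        · subst hi
          exact hm m
        · have h0 : (i : ℕ) ≠ 0 := fun h => hi (Fin.ext h)
          refine (dif_neg (fun h => hi (Option.some_injective _ h))).trans ?_
          change [] = List.replicate _ _
          rw [Function.update_of_ne h0]
          rfl
    have h2 : Turing.haltList (machine N c) (CNFList.encode (f m)) =
        ⟨none, false, stackOf N 0 (CNFList.encode (f m))⟩ := by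
      unfold Turing.haltList
      congr 1
      funext k
      match k with
      | none => rfl
      | some i => rfl
    rw [h1, h2]
    refine (congrArg _ hv).trans ?_
    rfl
  choose t ht hk using key
  refine ⟨{ tm := machine N c, inputAlphabet := Equiv.refl _, outputAlphabet := Equiv.refl _,
            time := P + 1, outputsFun := fun m => ⟨⟨t m + 1, ?_⟩, ?_⟩ }, ?_⟩
  · refine Eq.trans ?_ ((hk m).trans ?_)
    · congr 2
      exact congrArg _ (List.map_id _)
    · change _ = some _
      congr 2
      exact (List.map_id _).symm
  · have hl : (Computability.unaryEncodingNat.encode m).length = m :=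
      Computability.unary_decode_encode_nat m
    rw [hl]
    simpa using ht m
  · rintro (_ | i)
    · exact inferInstanceAs (Finite CNFSymbol)
    · exact inferInstanceAs (Finite Bool)

/-! ### Elementary programs and their running times. -/

namespace CounterProg

open Function

/-- `c` transforms the counters `σ` and the output `o` into `σ'` and `o'` in at most `T` steps. -/
def Runs (c : CounterProg) (σ : ℕ → ℕ) (o : List CNFSymbol) (T : ℕ) (σ' : ℕ → ℕ)
    (o' : List CNFSymbol) : Prop :=
  ∃ t ≤ T, Exec c σ o t σ' o'

theorem Runs.mono {c σ o T T' σ' o'} (h : Runs c σ o T σ' o') (hT : T ≤ T') :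
    Runs c σ o T' σ' o' := by
  obtain ⟨t, ht, h⟩ := h
  exact ⟨t, ht.trans hT, h⟩

theorem Runs.congr {c σ o T T' σ₁ σ' o'} (h : Runs c σ o T σ₁ o') (hσ : σ' = σ₁) (hT : T ≤ T') :
    Runs c σ o T' σ' o' :=
  hσ ▸ h.mono hT

theorem runs_inc (r σ o) : Runs (inc r) σ o 1 (update σ r (σ r + 1)) o := ⟨1, le_refl _, .inc ..⟩

theorem runs_dec (r σ o) : Runs (dec r) σ o 1 (update σ r (σ r - 1)) o := ⟨1, le_refl _, .dec ..⟩

theorem runs_emit (s σ o) : Runs (emit s) σ o 1 σ (s :: o) := ⟨1, le_refl _, .emit ..⟩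

theorem Runs.seq {c₁ c₂ σ o T₁ σ₁ o₁ T₂ σ₂ o₂} (h₁ : Runs c₁ σ o T₁ σ₁ o₁)
    (h₂ : Runs c₂ σ₁ o₁ T₂ σ₂ o₂) : Runs (seq c₁ c₂) σ o (T₁ + T₂) σ₂ o₂ := by
  obtain ⟨t₁, ht₁, h₁⟩ := h₁
  obtain ⟨t₂, ht₂, h₂⟩ := h₂
  exact ⟨t₁ + t₂, by omega, h₁.seq h₂⟩

/-- The index is the number of rounds still to go, so the states run from `S n` down to `S 0`. Each
round pays one step for its test, and the last failing test pays one more. -/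
theorem Runs.loop {r c T n} (S : ℕ → ℕ → ℕ) (o : ℕ → List CNFSymbol)
    (h0 : S 0 r = 0) (hS : ∀ i < n, S (i + 1) r ≠ 0)
    (h : ∀ i < n, Runs c (S (i + 1)) (o (i + 1)) T (S i) (o i)) :
    Runs (loop r c) (S n) (o n) (n * (T + 1) + 1) (S 0) (o 0) := by
  induction n with
  | zero => exact ⟨1, by simp, .loop_zero h0⟩
  | succ n ih =>
    obtain ⟨t₂, ht₂, h₂⟩ := ih (fun i hi => hS i (by omega)) (fun i hi => h i (by omega))
    obtain ⟨t₁, ht₁, h₁⟩ := h n (by omega)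
    refine ⟨1 + t₁ + t₂, ?_, .loop_succ (hS n (by omega)) h₁ h₂⟩
    rw [Nat.succ_mul]
    omega

/-- Set a counter to zero. -/
def clear (r : ℕ) : CounterProg := loop r (dec r)

theorem runs_clear (r σ o) : Runs (clear r) σ o (2 * σ r + 1) (update σ r 0) o := by
  have := Runs.loop (r := r) (c := dec r) (n := σ r) (T := 1) (fun i => update σ r i)
    (fun _ => o) (by simp) (by simp) (fun i _ => by simpa using runs_dec r (update σ r (i + 1)) o)
  simp only [update_eq_self] at this
  exact this.mono (by omega)

/-- Add the counter `r` to the counter `q` and set `r` to zero. -/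
def move (r q : ℕ) : CounterProg := loop r (seq (dec r) (inc q))

theorem runs_move {r q : ℕ} (hrq : r ≠ q) (σ o) :
    Runs (move r q) σ o (3 * σ r + 1) (update (update σ q (σ q + σ r)) r 0) o := by
  have := Runs.loop (r := r) (c := seq (dec r) (inc q)) (n := σ r) (T := 2)
    (fun i => update (update σ q (σ q + (σ r - i))) r i)
    (fun _ => o) (by simp) (by simp) (fun i hi => by
      convert (runs_dec r _ o).seq (runs_inc q _ o) using 1
      funext j
      by_cases hr : j = r
      · subst hr; simp [hrq]
      by_cases hq : j = q
      · subst hq; simp [hr]; omega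
      simp [hr, hq])
  simp only [Nat.sub_self, Nat.sub_zero, add_zero, update_eq_self] at this
  exact this.mono (by omega)

/-- Add the counter `r` to the counter `q`, using `s` as a temporary counter. -/
def copy (r q s : ℕ) : CounterProg :=
  seq (loop r (seq (dec r) (seq (inc q) (inc s)))) (move s r)

theorem runs_copy {r q s : ℕ} (hrq : r ≠ q) (hrs : r ≠ s) (hqs : q ≠ s) (σ o) (hs : σ s = 0) :
    Runs (copy r q s) σ o (7 * σ r + 2) (update σ q (σ q + σ r)) o := by
  have h1 := Runs.loop (r := r) (c := seq (dec r) (seq (inc q) (inc s))) (n := σ r) (T := 3)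
    (fun i => update (update (update σ q (σ q + (σ r - i))) s (σ r - i)) r i)
    (fun _ => o) (by simp) (by simp) (fun i hi => by
      convert (runs_dec r _ o).seq ((runs_inc q _ o).seq (runs_inc s _ o)) using 1
      funext j
      by_cases hr : j = r
      · subst hr; simp [hrq, hrs]
      by_cases hq : j = q
      · subst hq; simp [hr, hqs]; omega
      by_cases hs : j = s
      · subst hs; simp [hr, hq]; omega
      simp [hr, hq, hs])
  simp only [Nat.sub_self, Nat.sub_zero, add_zero, update_eq_self] at h1
  have h2 := h1.seq (runs_move hrs.symm _ o)
  have h3 : update (update (update σ q (σ q)) s 0) r (σ r) = σ := by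
    funext j
    by_cases hr : j = r
    · subst hr; simp
    by_cases hj : j = s
    · subst hj; simp [hr, hs]
    simp [hr, hj]
  simp only [update_eq_self] at h3
  rw [h3] at h2
  unfold copy
  convert h2.mono (T' := 7 * σ r + 2) _ using 1
  · funext j
    by_cases hr : j = r
    · subst hr; simp [hrq, hrs, hrs.symm]
    by_cases hj : j = s
    · rw [hj]; simp [hs, hqs.symm]
    simp [hr, hj, update_apply]
  · rw [update_of_ne hrs.symm, update_self]
    omega

/-! ### Polynomial-time functions and outputs of environments. -/

/-- Environments with an additional first entry. -/
def consEnv (x : ℕ) (a : ℕ → ℕ) : ℕ → ℕ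
  | 0 => x
  | n + 1 => a n

theorem comp_consEnv (σ ρ : ℕ → ℕ) (b : ℕ) :
    (fun j => σ (consEnv b ρ j)) = consEnv (σ b) (fun j => σ (ρ j)) := by
  funext j
  cases j <;> rfl

/-- A function of environments is computable in polynomial time by counter programs: if the
environment is stored in counters below `b` and the counters from `b` on are zero, then the value
is written into the counter `b`, and nothing else is changed. -/
def Comp (g : (ℕ → ℕ) → ℕ) : Prop :=
  ∃ P : Polynomial ℕ, (∀ a M, (∀ j, a j ≤ M) → g a ≤ P.eval M) ∧
    ∀ (b : ℕ) (ρ : ℕ → ℕ), (∀ j, ρ j < b) → ∃ c, ∀ σ o M, (∀ j, b ≤ j → σ j = 0) → (∀ j, σ j ≤ M) →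
      Runs c σ o (P.eval M) (update σ b (g fun j => σ (ρ j))) o

/-- A list of symbols that depends on an environment is written in polynomial time by counter
programs. -/
def Emits (E : (ℕ → ℕ) → List CNFSymbol) : Prop :=
  ∃ P : Polynomial ℕ, ∀ (b : ℕ) (ρ : ℕ → ℕ), (∀ j, ρ j < b) → ∃ c, ∀ σ o M,
    (∀ j, b ≤ j → σ j = 0) → (∀ j, σ j ≤ M) → Runs c σ o (P.eval M) σ (E (fun j => σ (ρ j)) ++ o)

theorem comp_var (j : ℕ) : Comp fun a => a j := by
  refine ⟨7 * Polynomial.X + 2, fun a M h => ?_, fun b ρ hρ => ⟨copy (ρ j) b (b + 1), ?_⟩⟩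
  · have := h j
    simp
    omega
  · intro σ o M h0 hM
    have hj := hρ j
    have := runs_copy (r := ρ j) (q := b) (s := b + 1) (by omega) (by omega) (by omega) σ o
      (h0 _ (by omega))
    rw [h0 b (le_refl _), zero_add] at this
    refine this.mono ?_
    have := hM (ρ j)
    simp
    omega

theorem comp_zero : Comp fun _ => 0 := by
  refine ⟨1, fun a M h => by simp, fun b ρ hρ => ⟨clear b, fun σ o M h0 hM => ?_⟩⟩
  refine (runs_clear b σ o).mono ?_
  simp [h0 b (le_refl _)]

theorem Comp.succ {g} (hg : Comp g) : Comp fun a => g a + 1 := by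
  obtain ⟨P, hP, hg⟩ := hg
  refine ⟨P + 1, fun a M h => by simpa using hP a M h, fun b ρ hρ => ?_⟩
  obtain ⟨c, hc⟩ := hg b ρ hρ
  refine ⟨seq c (inc b), fun σ o M h0 hM => ?_⟩
  convert (hc σ o M h0 hM).seq (runs_inc b _ o) using 1
  · simp
  · simp

theorem comp_const (n : ℕ) : Comp fun _ => n := by
  induction n with
  | zero => exact comp_zero
  | succ n ih => exact ih.succ

theorem Comp.rename {g} (hg : Comp g) (τ : ℕ → ℕ) : Comp fun a => g fun j => a (τ j) := by
  obtain ⟨P, hP, hg⟩ := hg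
  exact ⟨P, fun a M h => hP _ _ fun j => h _, fun b ρ hρ => hg b (fun j => ρ (τ j)) fun j => hρ _⟩

theorem Comp.shift {g} (hg : Comp g) : Comp fun a => g fun j => a (j + 1) := hg.rename _

/-- Two values are computed one after the other, and combined by a final program. -/
theorem Comp.binary {g h : (ℕ → ℕ) → ℕ} (hg : Comp g) (hh : Comp h) (F : ℕ → ℕ → ℕ)
    (Q : Polynomial ℕ) (hF : ∀ x y M, x ≤ M → y ≤ M → F x y ≤ Q.eval M)
    (hc : ∀ b, ∃ c, ∀ σ o M, σ b ≤ M → σ (b + 1) ≤ M →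
      Runs c σ o (Q.eval M) (update (update σ b (F (σ b) (σ (b + 1)))) (b + 1) 0) o) :
    Comp fun a => F (g a) (h a) := by
  obtain ⟨P₁, hP₁, hg⟩ := hg
  obtain ⟨P₂, hP₂, hh⟩ := hh
  -- The second program starts when the counter `b` already holds `g a`, so its counters are bounded
  -- by `M + P₁(M)`; the combining program only looks at the two values, which are at most `P₁(M) +
  -- P₂(M)`.
  refine ⟨P₁ + P₂.comp (Polynomial.X + P₁) + Q.comp (P₁ + P₂), fun a M hM => ?_,
    fun b ρ hρ => ?_⟩
  · have := hF (g a) (h a) ((P₁ + P₂).eval M) (by simpa using (hP₁ a M hM).trans (by omega))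
      (by simpa using (hP₂ a M hM).trans (by omega))
    simp only [Polynomial.eval_add, Polynomial.eval_comp] at this ⊢
    omega
  · obtain ⟨c₁, hc₁⟩ := hg b ρ hρ
    obtain ⟨c₂, hc₂⟩ := hh (b + 1) ρ fun j => (hρ j).trans (Nat.lt_succ_self b)
    obtain ⟨c₃, hc₃⟩ := hc b
    refine ⟨seq c₁ (seq c₂ c₃), fun σ o M h0 hM => ?_⟩
    have r₁ := hc₁ σ o M h0 hM
    have hb₁ := hP₁ (fun j => σ (ρ j)) M fun j => hM _
    have hb₂ := hP₂ (fun j => σ (ρ j)) M fun j => hM _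
    set x := g fun j => σ (ρ j)
    have henv : (fun j => update σ b x (ρ j)) = fun j => σ (ρ j) := by
      funext j
      exact update_of_ne (hρ j).ne _ _
    have r₂ := hc₂ (update σ b x) o (M + P₁.eval M)
      (fun j hj => by rw [update_of_ne (by omega)]; exact h0 j (by omega))
      (fun j => by
        by_cases hj : j = b
        · rw [hj]; simp; omega
        · rw [update_of_ne hj]; have := hM j; omega)
    rw [henv] at r₂
    set y := h fun j => σ (ρ j)
    have r₃ := hc₃ (update (update σ b x) (b + 1) y) o (P₁.eval M + P₂.eval M)
      (by rw [update_of_ne (by omega), update_self]; omega)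
      (by rw [update_self]; omega)
    convert (r₁.seq (r₂.seq r₃)) using 1
    · simp only [Polynomial.eval_add, Polynomial.eval_comp, Polynomial.eval_X]
      omega
    · funext j
      by_cases hj : j = b + 1
      · rw [hj]; simp [h0]
      by_cases hj' : j = b
      · rw [hj']; simp; rfl
      simp [hj, hj']

theorem Comp.add {g h} (hg : Comp g) (hh : Comp h) : Comp fun a => g a + h a := by
  refine hg.binary hh (· + ·) (3 * Polynomial.X + 1) (fun x y M hx hy => by simp; omega)
    fun b => ⟨move (b + 1) b, fun σ o M h1 h2 => ?_⟩
  exact (runs_move (by omega) σ o).mono (by simp; omega)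

theorem Comp.sub {g h} (hg : Comp g) (hh : Comp h) : Comp fun a => g a - h a := by
  refine hg.binary hh (· - ·) (3 * Polynomial.X + 1) (fun x y M hx hy => by simp; omega)
    fun b => ⟨loop (b + 1) (seq (dec (b + 1)) (dec b)), fun σ o M h1 h2 => ?_⟩
  have := Runs.loop (r := b + 1) (c := seq (dec (b + 1)) (dec b)) (n := σ (b + 1)) (T := 2)
    (fun i => update (update σ b (σ b - (σ (b + 1) - i))) (b + 1) i)
    (fun _ => o) (by simp) (by simp) (fun i hi => by
      convert (runs_dec (b + 1) _ o).seq (runs_dec b _ o) using 1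
      funext j
      by_cases hr : j = b + 1
      · subst hr; simp
      by_cases hq : j = b
      · subst hq; simp; omega
      simp [hr, hq])
  simp only [Nat.sub_self, Nat.sub_zero, update_eq_self] at this
  exact this.mono (by simp; omega)

/-- The loop counter `b` doubles as the summation index and is passed to the body as the first
variable. The summand is computed in `b + 2` and moved to the accumulator `b + 1`. As the index
descends, the partial sums run over `range n \ range i`. -/
theorem Comp.sum {g n} (hg : Comp g) (hn : Comp n) :
    Comp fun a => ∑ i ∈ Finset.range (n a), g (consEnv i a) := by
  obtain ⟨P₁, hP₁, hg⟩ := hg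
  obtain ⟨P₂, hP₂, hn⟩ := hn
  have hb : ∀ a M, (∀ j, a j ≤ M) → ∀ i < n a, g (consEnv i a) ≤ P₁.eval (M + P₂.eval M) := by
    intro a M hM i hi
    have h1 := hP₂ a M hM
    refine hP₁ _ _ fun j => ?_
    cases j with
    | zero => change i ≤ _; omega
    | succ j => have := hM j; change a j ≤ _; omega
  have hs : ∀ a M, (∀ j, a j ≤ M) → ∀ i ≤ n a, ∑ k ∈ Finset.range (n a) \ Finset.range i,
      g (consEnv k a) ≤ P₂.eval M * P₁.eval (M + P₂.eval M) := by
    intro a M hM i hi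
    refine (Finset.sum_le_card_nsmul _ _ (P₁.eval (M + P₂.eval M)) fun k hk => ?_).trans ?_
    · exact hb a M hM k (by simpa using (Finset.mem_sdiff.1 hk).1)
    · rw [smul_eq_mul]
      refine Nat.mul_le_mul_right _ ((Finset.card_le_card Finset.sdiff_subset).trans ?_)
      simpa using hP₂ a M hM
  -- polynomials for the sum, and for the cost of one round of the loop
  let S : Polynomial ℕ := P₂ * P₁.comp (Polynomial.X + P₂)
  let R : Polynomial ℕ := 1 + P₁.comp (Polynomial.X + P₂ + S) +
    (3 * P₁.comp (Polynomial.X + P₂) + 1)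
  refine ⟨P₂ + (P₂ * (R + 1) + 1) + (3 * S + 1), fun a M hM => ?_, fun b ρ hρ => ?_⟩
  · have := hs a M hM 0 (Nat.zero_le _)
    simp only [Finset.range_zero, Finset.sdiff_empty] at this
    simp only [S, Polynomial.eval_add, Polynomial.eval_mul, Polynomial.eval_comp,
      Polynomial.eval_X, Polynomial.eval_ofNat]
    omega
  · obtain ⟨c₂, hc₂⟩ := hn b ρ hρ
    obtain ⟨c₁, hc₁⟩ := hg (b + 2) (consEnv b ρ) fun j => by
      cases j with
      | zero => exact Nat.lt_add_of_pos_right (by omega)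
      | succ j => exact (hρ j).trans (by omega)
    refine ⟨seq c₂ (seq (loop b (seq (dec b) (seq c₁ (move (b + 2) (b + 1))))) (move (b + 1) b)),
      fun σ o M h0 hM => ?_⟩
    have r₂ := hc₂ σ o M h0 hM
    set a : ℕ → ℕ := fun j => σ (ρ j) with ha
    have haM : ∀ j, a j ≤ M := fun j => hM _
    have hb₂ := hP₂ a M haM
    have r₃ := Runs.loop (r := b) (c := seq (dec b) (seq c₁ (move (b + 2) (b + 1)))) (n := n a)
      (T := R.eval M)
      (fun i => update (update σ b i) (b + 1)
        (∑ k ∈ Finset.range (n a) \ Finset.range i, g (consEnv k a)))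
      (fun _ => o) (by simp) (by simp) (fun i hi => by
        have hsi := hs a M haM (i + 1) hi
        set s := ∑ k ∈ Finset.range (n a) \ Finset.range (i + 1), g (consEnv k a) with hsdef
        have hstep : ∑ k ∈ Finset.range (n a) \ Finset.range i, g (consEnv k a)
            = s + g (consEnv i a) := by
          have : Finset.range (n a) \ Finset.range i
              = insert i (Finset.range (n a) \ Finset.range (i + 1)) := by
            ext k
            simp
            omega
          rw [this, Finset.sum_insert (by simp), add_comm]
        have q₁ := runs_dec b (update (update σ b (i + 1)) (b + 1) s) o
        have e₁ : update (update (update σ b (i + 1)) (b + 1) s) b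
            (update (update σ b (i + 1)) (b + 1) s b - 1) = update (update σ b i) (b + 1) s := by
          funext j
          by_cases hj : j = b + 1
          · rw [hj]; simp
          by_cases hj' : j = b
          · rw [hj']; simp
          simp [hj, hj']
        rw [e₁] at q₁
        have q₂ := hc₁ (update (update σ b i) (b + 1) s) o (M + P₂.eval M + S.eval M)
          (fun j hj => by
            rw [update_of_ne (by omega), update_of_ne (by omega)]; exact h0 j (by omega))
          (fun j => by
            by_cases hj : j = b + 1
            · subst hj
              rw [update_self]
              simp only [S, Polynomial.eval_mul, Polynomial.eval_comp, Polynomial.eval_add,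
                Polynomial.eval_X]
              omega
            by_cases hj' : j = b
            · subst hj'
              rw [update_of_ne hj, update_self]
              omega
            · rw [update_of_ne hj, update_of_ne hj']; have := hM j; omega)
        have henv : (fun j => update (update σ b i) (b + 1) s (consEnv b ρ j)) = consEnv i a := by
          rw [comp_consEnv, update_of_ne (by omega), update_self]
          congr 1
          funext j
          have := hρ j
          rw [update_of_ne (by omega), update_of_ne (by omega)]
        rw [henv] at q₂
        have hgi := hb a M haM i hi
        refine (q₁.seq (q₂.seq (runs_move (r := b + 2) (q := b + 1) (by omega) _ o))).congr ?_ ?_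
        · funext j
          by_cases hj : j = b + 2
          · rw [hj]; simp [h0]
          by_cases hj' : j = b + 1
          · rw [hj']; simp [hstep]
          simp [hj, hj']
        · simp [R, S]
          omega)
    simp only [Finset.sdiff_self, Finset.sum_empty, Finset.range_zero, Finset.sdiff_empty] at r₃
    have e₂ : update (update σ b (n a)) (b + 1) 0 = update σ b (n a) := by
      conv_rhs => rw [← update_eq_self (b + 1) (update σ b (n a))]
      rw [update_of_ne (by omega : b + 1 ≠ b), h0 (b + 1) (by omega)]
    rw [e₂] at r₃
    have hs0 := hs a M haM 0 (Nat.zero_le _)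
    simp only [Finset.range_zero, Finset.sdiff_empty] at hs0
    refine (r₂.seq (r₃.seq (runs_move (r := b + 1) (q := b) (by omega) _ o))).congr ?_ ?_
    · funext j
      by_cases hj : j = b + 1
      · rw [hj]; simp [h0]
      by_cases hj' : j = b
      · rw [hj']; simp
      simp [hj, hj']
    · have : n a * (R.eval M + 1) ≤ P₂.eval M * (R.eval M + 1) := Nat.mul_le_mul_right _ hb₂
      simp [S]
      omega

/-- The bound on all iterates cannot be derived: iterating a doubling would be exponential. With it,
the current iterate is kept in `b + 1`, and the next one is computed in `b + 2` and moved back. -/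
theorem Comp.iterate {n x : (ℕ → ℕ) → ℕ} {g : (ℕ → ℕ) → ℕ} (hn : Comp n) (hx : Comp x)
    (hg : Comp g) (Q : Polynomial ℕ)
    (hQ : ∀ a M k, (∀ j, a j ≤ M) → (fun v => g (consEnv v a))^[k] (x a) ≤ Q.eval M) :
    Comp fun a => (fun v => g (consEnv v a))^[n a] (x a) := by
  obtain ⟨P₁, hP₁, hg⟩ := hg
  obtain ⟨P₂, hP₂, hn⟩ := hn
  obtain ⟨P₃, hP₃, hx⟩ := hx
  let R : Polynomial ℕ := 1 + P₁.comp (Polynomial.X + P₂ + Q) + (2 * Q + 1) + (3 * Q + 1)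
  refine ⟨P₂ + P₃.comp (Polynomial.X + P₂) + (P₂ * (R + 1) + 1) + (3 * Q + 1),
    fun a M hM => ?_, fun b ρ hρ => ?_⟩
  · have := hQ a M (n a) hM
    simp only [Polynomial.eval_add, Polynomial.eval_mul, Polynomial.eval_ofNat]
    omega
  · obtain ⟨c₂, hc₂⟩ := hn b ρ hρ
    obtain ⟨c₃, hc₃⟩ := hx (b + 1) ρ fun j => (hρ j).trans (Nat.lt_succ_self b)
    obtain ⟨c₁, hc₁⟩ := hg (b + 2) (consEnv (b + 1) ρ) fun j => by
      cases j with
      | zero => exact Nat.lt_succ_self (b + 1)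
      | succ j => exact (hρ j).trans (by omega)
    refine ⟨seq c₂ (seq c₃ (seq (loop b (seq (dec b) (seq c₁ (seq (clear (b + 1))
      (move (b + 2) (b + 1)))))) (move (b + 1) b))), fun σ o M h0 hM => ?_⟩
    have r₂ := hc₂ σ o M h0 hM
    set a : ℕ → ℕ := fun j => σ (ρ j) with ha
    have haM : ∀ j, a j ≤ M := fun j => hM _
    have hb₂ := hP₂ a M haM
    have r₃ := hc₃ (update σ b (n a)) o (M + P₂.eval M)
      (fun j hj => by rw [update_of_ne (by omega)]; exact h0 j (by omega))
      (fun j => by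
        by_cases hj : j = b
        · rw [hj]; simp; omega
        · rw [update_of_ne hj]; have := hM j; omega)
    have henv₃ : (fun j => update σ b (n a) (ρ j)) = a := by
      funext j
      exact update_of_ne (hρ j).ne _ _
    rw [henv₃] at r₃
    set G : ℕ → ℕ := fun v => g (consEnv v a) with hG
    have r₄ := Runs.loop (r := b) (c := seq (dec b) (seq c₁ (seq (clear (b + 1))
        (move (b + 2) (b + 1))))) (n := n a) (T := R.eval M)
      (fun i => update (update σ b i) (b + 1) (G^[n a - i] (x a)))
      (fun _ => o) (by simp) (by simp) (fun i hi => by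
        have hsi := hQ a M (n a - (i + 1)) haM
        have hsi' := hQ a M (n a - i) haM
        change G^[_] _ ≤ _ at hsi hsi'
        have hstep : G^[n a - i] (x a) = G (G^[n a - (i + 1)] (x a)) := by
          rw [← iterate_succ_apply' G]
          congr 2
          omega
        rw [hstep] at hsi'
        rw [hstep]
        set s := G^[n a - (i + 1)] (x a) with hsdef
        have q₁ := runs_dec b (update (update σ b (i + 1)) (b + 1) s) o
        have e₁ : update (update (update σ b (i + 1)) (b + 1) s) b
            (update (update σ b (i + 1)) (b + 1) s b - 1) = update (update σ b i) (b + 1) s := by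
          funext j
          by_cases hj : j = b + 1
          · rw [hj]; simp
          by_cases hj' : j = b
          · rw [hj']; simp
          simp [hj, hj']
        rw [e₁] at q₁
        have q₂ := hc₁ (update (update σ b i) (b + 1) s) o (M + P₂.eval M + Q.eval M)
          (fun j hj => by
            rw [update_of_ne (by omega), update_of_ne (by omega)]; exact h0 j (by omega))
          (fun j => by
            by_cases hj : j = b + 1
            · subst hj
              rw [update_self]
              omega
            by_cases hj' : j = b
            · subst hj'
              rw [update_of_ne hj, update_self]
              omega
            · rw [update_of_ne hj, update_of_ne hj']; have := hM j; omega)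
        have henv : (fun j => update (update σ b i) (b + 1) s (consEnv (b + 1) ρ j))
            = consEnv s a := by
          rw [comp_consEnv, update_self]
          congr 1
          funext j
          have := hρ j
          rw [update_of_ne (by omega), update_of_ne (by omega)]
        rw [henv] at q₂
        change Runs _ _ _ _ (update _ _ (G s)) _ at q₂
        refine (q₁.seq (q₂.seq ((runs_clear (b + 1) _ o).seq
            (runs_move (r := b + 2) (q := b + 1) (by omega) _ o)))).congr ?_ ?_
        · funext j
          by_cases hj : j = b + 2
          · rw [hj]; simp [h0]
          by_cases hj' : j = b + 1
          · rw [hj']; simp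
          simp [hj, hj']
        · simp [R]
          omega)
    simp only [Nat.sub_self, Nat.sub_zero, iterate_zero, id_eq] at r₄
    have hs0 := hQ a M (n a) haM
    change G^[_] _ ≤ _ at hs0
    refine (r₂.seq (r₃.seq (r₄.seq (runs_move (r := b + 1) (q := b) (by omega) _ o)))).congr ?_ ?_
    · funext j
      by_cases hj : j = b + 1
      · rw [hj]; simp [h0]
      by_cases hj' : j = b
      · rw [hj']; simp; rfl
      simp [hj, hj']
    · have : n a * (R.eval M + 1) ≤ P₂.eval M * (R.eval M + 1) := Nat.mul_le_mul_right _ hb₂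
      simp
      omega

theorem emits_symbol (s : CNFSymbol) : Emits fun _ => [s] :=
  ⟨1, fun _ _ _ => ⟨emit s, fun σ o M _ _ => by simpa using runs_emit s σ o⟩⟩

/-- The output is a stack, so the second part has to be written first. -/
theorem Emits.append {E F} (hE : Emits E) (hF : Emits F) : Emits fun a => E a ++ F a := by
  obtain ⟨P, hE⟩ := hE
  obtain ⟨Q, hF⟩ := hF
  refine ⟨Q + P, fun b ρ hρ => ?_⟩
  obtain ⟨c, hc⟩ := hE b ρ hρ
  obtain ⟨c', hc'⟩ := hF b ρ hρ
  refine ⟨seq c' c, fun σ o M h0 hM => ?_⟩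
  rw [Polynomial.eval_add, List.append_assoc]
  exact (hc' σ o M h0 hM).seq (hc _ _ M h0 hM)

/-- Descending loops suit a stack: the block with the largest index is pushed first and ends up
deepest. -/
theorem Emits.flatMap_range {E n} (hE : Emits E) (hn : Comp n) :
    Emits fun a => (List.range (n a)).flatMap fun i => E (consEnv i a) := by
  obtain ⟨P, hE⟩ := hE
  obtain ⟨P₂, hP₂, hn⟩ := hn
  let R : Polynomial ℕ := 1 + P.comp (Polynomial.X + P₂)
  refine ⟨P₂ + (P₂ * (R + 1) + 1), fun b ρ hρ => ?_⟩
  obtain ⟨c₂, hc₂⟩ := hn b ρ hρ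
  obtain ⟨c₁, hc₁⟩ := hE (b + 1) (consEnv b ρ) fun j => by
    cases j with
    | zero => exact Nat.lt_succ_self b
    | succ j => exact (hρ j).trans (Nat.lt_succ_self b)
  refine ⟨seq c₂ (loop b (seq (dec b) c₁)), fun σ o M h0 hM => ?_⟩
  have r₂ := hc₂ σ o M h0 hM
  set a : ℕ → ℕ := fun j => σ (ρ j) with ha
  have hb₂ := hP₂ a M fun j => hM _
  have r₃ := Runs.loop (r := b) (c := seq (dec b) c₁) (n := n a) (T := R.eval M)
    (fun i => update σ b i)
    (fun i => ((List.range' i (n a - i)).flatMap fun k => E (consEnv k a)) ++ o)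
    (by simp) (by simp) (fun i hi => by
      have q₁ := runs_dec b (update σ b (i + 1))
        (((List.range' (i + 1) (n a - (i + 1))).flatMap fun k => E (consEnv k a)) ++ o)
      simp only [update_self, Nat.add_sub_cancel, update_idem] at q₁
      have henv : (fun j => update σ b i (consEnv b ρ j)) = consEnv i a := by
        rw [comp_consEnv, update_self]
        congr 1
        funext j
        exact update_of_ne (hρ j).ne _ _
      have q₂ := hc₁ (update σ b i)
        (((List.range' (i + 1) (n a - (i + 1))).flatMap fun k => E (consEnv k a)) ++ o)
        (M + P₂.eval M)
        (fun j hj => by rw [update_of_ne (by omega)]; exact h0 j (by omega))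
        (fun j => by
          by_cases hj : j = b
          · rw [hj]; simp; omega
          · rw [update_of_ne hj]; have := hM j; omega)
      rw [henv, ← List.append_assoc] at q₂
      have hrange : List.range' i (n a - i) = i :: List.range' (i + 1) (n a - (i + 1)) := by
        rw [← List.range'_succ, show n a - (i + 1) + 1 = n a - i by omega]
      rw [hrange, List.flatMap_cons]
      refine (q₁.seq q₂).mono (by simp [R]))
  simp only [Nat.sub_self, Nat.sub_zero, List.range'_zero, List.flatMap_nil, List.nil_append,
    ← List.range_eq_range'] at r₃
  have e₂ : update σ b 0 = σ := by
    conv_rhs => rw [← update_eq_self b σ]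
    rw [h0 b (le_refl _)]
  rw [e₂] at r₃
  refine (r₂.seq r₃).mono ?_
  have : n a * (R.eval M + 1) ≤ P₂.eval M * (R.eval M + 1) := Nat.mul_le_mul_right _ hb₂
  simp
  omega

end CounterProg

open CounterProg in
-- All variables of the environment are read from the counter `0`, which holds `m` and is cleared at
-- the end.
theorem polyTimeProduced_of_emits {f : ℕ → CNFList} {E : (ℕ → ℕ) → List CNFSymbol}
    (hE : Emits E) (h : ∀ m, CNFList.encode (f m) = E fun _ => m) : PolyTimeProduced f := by
  obtain ⟨P, hE⟩ := hE
  obtain ⟨c, hc⟩ := hE 1 (fun _ => 0) fun _ => Nat.one_pos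
  refine polyTimeProduced_of_exec (seq c (clear 0)) (P + (2 * Polynomial.X + 1)) fun m => ?_
  have r := (hc (Function.update 0 0 m) [] m
    (fun j hj => by rw [Function.update_of_ne (by omega)]; rfl)
    (fun j => by by_cases hj : j = 0 <;> simp [hj])).seq (runs_clear 0 _ _)
  simpa [h, Runs] using r

/-! ### Arithmetic in polynomial time. -/

namespace CounterProg

theorem Comp.mul {g h} (hg : Comp g) (hh : Comp h) : Comp fun a => g a * h a := by
  have := hh.shift.sum hg
  simpa [consEnv] using this

theorem Comp.pow {g} (hg : Comp g) (k : ℕ) : Comp fun a => g a ^ k := by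
  induction k with
  | zero => simpa using comp_const 1
  | succ k ih => simpa only [pow_succ] using ih.mul hg

theorem Comp.min {g h} (hg : Comp g) (hh : Comp h) : Comp fun a => min (g a) (h a) := by
  have := hg.sub (hg.sub hh)
  convert this using 2
  omega

/-- With truncated subtraction, `1 - (h a - g a)` is the indicator of `h a ≤ g a`, and it selects
the branch by multiplication. -/
theorem Comp.ite_lt {g h x y} (hg : Comp g) (hh : Comp h) (hx : Comp x) (hy : Comp y) :
    Comp fun a => if g a < h a then x a else y a := by
  have h1 := (comp_const 1).sub (hh.sub hg)
  have := (((comp_const 1).sub h1).mul hx).add (h1.mul hy)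
  convert this using 2 with a
  split_ifs with hlt
  · rw [show 1 - (h a - g a) = 0 by omega]
    simp
  · rw [show 1 - (h a - g a) = 1 by omega]
    simp

theorem Comp.pair {g h} (hg : Comp g) (hh : Comp h) : Comp fun a => Nat.pair (g a) (h a) :=
  hg.ite_lt hh ((hh.mul hh).add hg) (((hg.mul hg).add hg).add hh)

/-- Halving is counting: `g a / 2` is the number of `i` with `2 * i + 1 < g a`. -/
theorem Comp.half {g} (hg : Comp g) : Comp fun a => g a / 2 := by
  have := (((comp_const 2).mul (comp_var 0)).add (comp_const 1)).ite_lt hg.shift (comp_const 1)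
    (comp_const 0) |>.sum hg
  convert this using 2 with a
  change _ = ∑ i ∈ Finset.range (g a), if 2 * i + 1 < g a then 1 else 0
  simp only [← Finset.sum_filter, Finset.sum_const, smul_eq_mul, mul_one]
  have hf : (Finset.range (g a)).filter (fun i => 2 * i + 1 < g a) = Finset.range (g a / 2) := by
    ext i
    simp only [Finset.mem_filter, Finset.mem_range]
    omega
  rw [hf, Finset.card_range]

/-- Repeated halving never exceeds the start value, whereas `2 ^ h a` itself may be exponentially
large. -/
theorem Comp.div_two_pow {g h} (hg : Comp g) (hh : Comp h) : Comp fun a => g a / 2 ^ h a := by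
  have hi : ∀ k c : ℕ, (fun v => v / 2)^[k] c = c / 2 ^ k := by
    intro k c
    induction k with
    | zero => simp
    | succ k ih => rw [Function.iterate_succ_apply', ih, Nat.div_div_eq_div_mul, pow_succ]
  obtain ⟨P, hP, -⟩ := id hg
  have := Comp.iterate hh hg (comp_var 0).half P fun a M k hM => by
    change (fun v => v / 2)^[k] (g a) ≤ _
    rw [hi]
    exact (Nat.div_le_self _ _).trans (hP a M hM)
  convert this using 2 with a
  exact (hi _ _).symm

/-- The power `2 ^ t`, truncated at `m`. -/
theorem Comp.min_two_pow {t m} (ht : Comp t) (hm : Comp m) :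
    Comp fun a => if 0 < m a then Min.min (2 ^ t a) (m a) else 0 := by
  -- Capping at `m` after every doubling keeps all iterates polynomial and commutes with the power.
  -- The start value `1` is at most the cap only if `m` is positive.
  have hi : ∀ m k : ℕ, 0 < m → (fun v => Min.min (2 * v) m)^[k] 1 = Min.min (2 ^ k) m := by
    intro m k hm
    induction k with
    | zero => simp; omega
    | succ k ih => rw [Function.iterate_succ_apply', ih, pow_succ]; omega
  obtain ⟨P, hP, -⟩ := id hm
  have h1 := Comp.iterate ht (comp_const 1) (((comp_const 2).mul (comp_var 0)).min hm.shift)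
    (P + 1) fun a M k hM => by
      change (fun v => Min.min (2 * v) (m a))^[k] 1 ≤ _
      have := hP a M hM
      rw [Polynomial.eval_add, Polynomial.eval_one]
      cases k with
      | zero => simp
      | succ k => rw [Function.iterate_succ_apply']; omega
  have h2 := (comp_const 0).ite_lt hm h1 (comp_const 0)
  convert h2 using 2 with a
  split_ifs with h
  · exact (hi _ _ h).symm
  · rfl

end CounterProg

/-! ### The parameters of the trees -/

/-- As `1 / 4.9 = 10 / 49`, taking 49th powers turns the comparison into one between natural
numbers, which a machine can decide. -/
theorem le_rpow_iff_pow_le_pow (x m : ℕ) : (x : ℝ) ≤ (m : ℝ) ^ (1 / 4.9 : ℝ) ↔ x ^ 49 ≤ m ^ 10 := by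
  have h1 : ((m : ℝ) ^ (1 / 4.9 : ℝ)) ^ 49 = (m : ℝ) ^ 10 := by
    rw [← Real.rpow_natCast, ← Real.rpow_mul (by positivity), ← Real.rpow_natCast]
    norm_num
  rw [← pow_le_pow_iff_left₀ (by positivity) (by positivity) (show 49 ≠ 0 by norm_num), h1]
  exact_mod_cast Iff.rfl

theorem rpow_le_iff_pow_le_pow (x m : ℕ) : (m : ℝ) ^ (1 / 4.9 : ℝ) ≤ x ↔ m ^ 10 ≤ x ^ 49 := by
  have h1 : ((m : ℝ) ^ (1 / 4.9 : ℝ)) ^ 49 = (m : ℝ) ^ 10 := by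
    rw [← Real.rpow_natCast, ← Real.rpow_mul (by positivity), ← Real.rpow_natCast]
    norm_num
  rw [← pow_le_pow_iff_left₀ (by positivity) (by positivity) (show 49 ≠ 0 by norm_num), h1]
  exact_mod_cast Iff.rfl

theorem le_numLeaves_iff (x m : ℕ) : x ≤ numLeaves m ↔ x ^ 49 ≤ m ^ 10 := by
  rw [numLeaves, Nat.le_floor_iff (by positivity), le_rpow_iff_pow_le_pow]

theorem treeDepth_le_iff (t m : ℕ) : treeDepth m ≤ t ↔ m ^ 10 ≤ (2 ^ t) ^ 49 := by
  rw [treeDepth, Nat.clog_le_iff_le_pow (by norm_num), Nat.ceil_le, ← rpow_le_iff_pow_le_pow]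

theorem pow_ten_le_pow (m : ℕ) : m ^ 10 ≤ m ^ 49 := by
  rcases Nat.eq_zero_or_pos m with rfl | h
  · simp
  · exact Nat.pow_le_pow_right h (by norm_num)

theorem numLeaves_le (m : ℕ) : numLeaves m ≤ m := by
  by_contra h
  have h1 := (le_numLeaves_iff (m + 1) m).1 (by omega)
  have h2 : m ^ 49 < (m + 1) ^ 49 := Nat.pow_lt_pow_left (by omega) (by norm_num)
  have := pow_ten_le_pow m
  omega

theorem treeDepth_le (m : ℕ) : treeDepth m ≤ m := by
  rw [treeDepth_le_iff]
  exact (pow_ten_le_pow m).trans (Nat.pow_le_pow_left Nat.lt_two_pow_self.le _)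

theorem numLeaves_le_two_pow (m : ℕ) : numLeaves m ≤ 2 ^ treeDepth m := by
  have h1 := (le_numLeaves_iff _ m).1 le_rfl
  have h2 := (treeDepth_le_iff _ m).1 le_rfl
  exact (Nat.pow_le_pow_iff_left (by norm_num)).1 (h1.trans h2)

/-- The floor is the number of positive integers `c + 1` that do not exceed the real power;
candidates up to `m` suffice. -/
theorem numLeaves_eq_sum (m : ℕ) :
    numLeaves m = ∑ c ∈ Finset.range m, if m ^ 10 < (c + 1) ^ 49 then 0 else 1 := by
  have : ∀ c, (if m ^ 10 < (c + 1) ^ 49 then 0 else 1) = if c < numLeaves m then 1 else 0 := by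
    intro c
    have := le_numLeaves_iff (c + 1) m
    split_ifs <;> omega
  simp only [this, ← Finset.sum_filter, Finset.sum_const, smul_eq_mul, mul_one]
  rw [show (Finset.range m).filter (· < numLeaves m) = Finset.range (numLeaves m) by
    ext c
    have := numLeaves_le m
    simp
    omega, Finset.card_range]

/-- The depth is the number of exponents `t` whose power `2 ^ t` is still too small. Truncating at
`m` is harmless, because `m` itself already passes the test `m ^ 10 ≤ m ^ 49`. -/
theorem treeDepth_eq_sum (m : ℕ) :
    treeDepth m = ∑ t ∈ Finset.range m,
      if (if 0 < m then min (2 ^ t) m else 0) ^ 49 < m ^ 10 then 1 else 0 := by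
  rcases Nat.eq_zero_or_pos m with rfl | hm
  · simpa using treeDepth_le 0
  have : ∀ t, (if (if 0 < m then min (2 ^ t) m else 0) ^ 49 < m ^ 10 then 1 else 0)
      = if t < treeDepth m then 1 else 0 := by
    intro t
    have h1 := treeDepth_le_iff t m
    have h2 := pow_ten_le_pow m
    rw [if_pos hm]
    rcases le_total (2 ^ t) m with h | h
    · rw [min_eq_left h]
      split_ifs <;> omega
    · rw [min_eq_right h]
      have h3 := Nat.pow_le_pow_left h 49
      split_ifs <;> omega
  simp only [this, ← Finset.sum_filter, Finset.sum_const, smul_eq_mul, mul_one]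
  rw [show (Finset.range m).filter (· < treeDepth m) = Finset.range (treeDepth m) by
    ext c
    have := treeDepth_le m
    simp
    omega, Finset.card_range]

namespace CounterProg

theorem comp_numLeaves (j : ℕ) : Comp fun a => numLeaves (a j) := by
  -- Inside the sum, variable `0` is the summation index and all others are shifted by one.
  have hm := (comp_var (j + 1)).pow 10
  have := (hm.ite_lt ((comp_var 0).succ.pow 49) (comp_const 0) (comp_const 1)).sum (comp_var j)
  convert this using 2 with a
  exact numLeaves_eq_sum _

theorem comp_treeDepth (j : ℕ) : Comp fun a => treeDepth (a j) := by
  have hm := (comp_var (j + 1)).pow 10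
  have := ((((comp_var 0).min_two_pow (comp_var (j + 1))).pow 49).ite_lt hm (comp_const 1)
    (comp_const 0)).sum (comp_var j)
  convert this using 2 with a
  exact treeDepth_eq_sum _

end CounterProg

/-! ### Bit strings -/

/-- The last `h` binary digits of `c`, the most significant one first. -/
def bitString : ℕ → ℕ → List Bool
  | 0, _ => []
  | h + 1, c => bitString h (c / 2) ++ [c % 2 == 1]

/-- The number with given binary digits, the most significant one first. -/
def bitValue (x : List Bool) : ℕ := x.foldl (fun v b => 2 * v + b.toNat) 0

theorem bitValue_concat (x : List Bool) (b : Bool) :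
    bitValue (x ++ [b]) = 2 * bitValue x + b.toNat := by
  simp [bitValue]

@[simp] theorem length_bitString (h c : ℕ) : (bitString h c).length = h := by
  induction h generalizing c with
  | zero => rfl
  | succ h ih => simp [bitString, ih]

theorem bitValue_bitString {h c : ℕ} (hc : c < 2 ^ h) : bitValue (bitString h c) = c := by
  induction h generalizing c with
  | zero => simp at hc; subst hc; rfl
  | succ h ih =>
    rw [bitString, bitValue_concat, ih (by rw [pow_succ] at hc; omega)]
    rcases Nat.mod_two_eq_zero_or_one c with h2 | h2 <;> simp [h2] <;> omega

theorem bitString_bitValue (x : List Bool) : bitString x.length (bitValue x) = x := by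
  induction x using List.reverseRecOn with
  | nil => rfl
  | append_singleton x b ih =>
    rw [bitValue_concat, List.length_append, List.length_singleton, bitString]
    cases b <;> simp [Nat.add_mod, Nat.add_div, ih]

/-- Dropping the last `s` binary digits is division by `2 ^ s`, so the ancestors of a leaf are
obtained by arithmetic on its number. -/
theorem prefix_bitString_iff {h c : ℕ} {x : List Bool} :
    x <+: bitString h c ↔ ∃ s ≤ h, x = bitString (h - s) (c / 2 ^ s) := by
  induction h generalizing c with
  | zero => simp [bitString]
  | succ h ih =>
    rw [bitString, List.prefix_concat_iff, ih]
    constructor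
    · rintro (rfl | ⟨s, hs, rfl⟩)
      · exact ⟨0, by omega, by simp [bitString]⟩
      · refine ⟨s + 1, by omega, ?_⟩
        rw [Nat.div_div_eq_div_mul, Nat.pow_succ', Nat.add_sub_add_right]
    · rintro ⟨s, hs, rfl⟩
      cases s with
      | zero => left; simp [bitString]
      | succ s =>
        right
        refine ⟨s, by omega, ?_⟩
        rw [Nat.div_div_eq_div_mul, Nat.pow_succ', Nat.add_sub_add_right]

/-! ### The formulas as lists -/

/-- The leaves with the smallest numbers. -/
noncomputable def firstLeaves (m : ℕ) : Finset (List Bool) :=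
  (Finset.range (numLeaves m)).image (bitString (treeDepth m))

theorem isLeafChoice_firstLeaves (m : ℕ) : IsLeafChoice m (firstLeaves m) := by
  refine ⟨fun ℓ hℓ => ?_, ?_⟩
  · obtain ⟨c, -, rfl⟩ := Finset.mem_image.1 hℓ
    simp
  · rw [firstLeaves, Finset.card_image_of_injOn, Finset.card_range]
    intro c hc c' hc' h
    have hb := numLeaves_le_two_pow m
    simp only [Finset.coe_range, Set.mem_Iio] at hc hc'
    rw [← bitValue_bitString (hc.trans_le hb), ← bitValue_bitString (hc'.trans_le hb)]
    exact congrArg bitValue h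

/-- The name of the node with height `s` above the leaf with number `c` in the tree `i`. -/
def nodeName (i s c : ℕ) : ℕ := 2 * Nat.pair i (Nat.pair s (c / 2 ^ s))

/-- The name of the subdivision vertex between the leaf `c₁` of the tree `i` and the leaf `c₂` of
the tree `j`. -/
def subdivName (i j c₁ c₂ : ℕ) : ℕ := 2 * Nat.pair (Nat.pair i j) (Nat.pair c₁ c₂) + 1

/-- The literals of a root-leaf path in a tree of depth `h`. -/
def pathList (h i c : ℕ) : List (ℕ × Bool) :=
  (List.range (h + 1)).map fun s => (nodeName i s c, true)

/-- The clause of a subdivision vertex. -/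
def clauseList (h i j c₁ c₂ : ℕ) : List (ℕ × Bool) :=
  pathList h i c₁ ++ ([(subdivName i j c₁ c₂, true)] ++ pathList h j c₂)

/-- The formula `φ(G_m)` as a list of clauses. -/
noncomputable def phiList (m : ℕ) : CNFList :=
  (List.range m).flatMap fun i => (List.range m).flatMap fun j =>
    -- A loop of length `0` or `1` plays the role of a conditional, so that nested loops are the
    -- only control structure.
    (List.range (if i < j then 1 else 0)).flatMap fun _ =>
      (List.range (numLeaves m)).flatMap fun c₁ =>
        (List.range (numLeaves m)).flatMap fun c₂ => [clauseList (treeDepth m) i j c₁ c₂]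

theorem mem_phiList {m : ℕ} {C : List (ℕ × Bool)} :
    C ∈ phiList m ↔ ∃ i < m, ∃ j < m, i < j ∧ ∃ c₁ < numLeaves m, ∃ c₂ < numLeaves m,
      C = clauseList (treeDepth m) i j c₁ c₂ := by
  simp only [phiList, List.mem_flatMap, List.mem_range, List.mem_singleton]
  constructor
  · rintro ⟨i, hi, j, hj, k, hk, c₁, h₁, c₂, h₂, rfl⟩
    refine ⟨i, hi, j, hj, ?_, c₁, h₁, c₂, h₂, rfl⟩
    by_contra h
    simp [h] at hk
  · rintro ⟨i, hi, j, hj, hij, c₁, h₁, c₂, h₂, rfl⟩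
    exact ⟨i, hi, j, hj, 0, by simp [hij], c₁, h₁, c₂, h₂, rfl⟩

theorem CNFList.encode_flatMap {α : Type} (l : List α) (F : α → CNFList) :
    CNFList.encode (l.flatMap F) = l.flatMap fun x => CNFList.encode (F x) := by
  simp only [CNFList.encode, List.flatMap_assoc]

/-! ### Writing down the formula. -/

namespace CounterProg

theorem emits_literal {g} (hg : Comp g) :
    Emits fun a => CNFList.encodeLiteral (g a, true) := by
  have := ((emits_symbol .tick).flatMap_range hg).append (emits_symbol (.endLiteral true))
  convert this using 2 with a
  simp only [CNFList.encodeLiteral, List.append_cancel_right_eq]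
  rw [← List.map_eq_flatMap]
  simp

theorem emits_pathList {h i c} (hh : Comp h) (hi : Comp i) (hc : Comp c) :
    Emits fun a => (pathList (h a) (i a) (c a)).flatMap CNFList.encodeLiteral := by
  have := (emits_literal ((comp_const 2).mul (hi.shift.pair ((comp_var 0).pair
    (hc.shift.div_two_pow (comp_var 0)))))).flatMap_range hh.succ
  convert this using 2 with a
  rw [pathList, List.flatMap_map]
  rfl

theorem emits_phiList : Emits fun a => CNFList.encode (phiList (a 0)) := by
  -- In the innermost loop the variables `0`, `1`, `3`, `4`, `5` are `c₂`, `c₁`, `j`, `i`, `m`;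
  -- variable `2` is the dummy index of the conditional.
  have hd := comp_treeDepth 5
  have h1 := (emits_pathList hd (comp_var 4) (comp_var 1)).append
    (((emits_literal (((comp_const 2).mul (((comp_var 4).pair (comp_var 3)).pair
      ((comp_var 1).pair (comp_var 0)))).succ)).append
      (emits_pathList hd (comp_var 3) (comp_var 0))).append (emits_symbol .endClause))
  have h2 := ((((h1.flatMap_range (comp_numLeaves 4)).flatMap_range
    (comp_numLeaves 3)).flatMap_range ((comp_var 1).ite_lt (comp_var 0) (comp_const 1)
    (comp_const 0))).flatMap_range (comp_var 1)).flatMap_range (comp_var 0)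
  convert h2 using 2 with a
  simp only [phiList, CNFList.encode_flatMap, consEnv]
  simp [CNFList.encode, CNFList.encodeClause, clauseList, subdivName]
  rfl

end CounterProg

theorem polyTimeProduced_phiList : PolyTimeProduced phiList :=
  polyTimeProduced_of_emits CounterProg.emits_phiList fun _ => rfl

/-! ### The names of the vertices -/

theorem length_treeNode_le {m : ℕ} {L : Finset (List Bool)} (hL : IsLeafChoice m L)
    (x : TreeNode L) : x.1.length ≤ treeDepth m := by
  obtain ⟨ℓ, hℓ, hx⟩ := Finset.mem_biUnion.1 x.2
  rw [List.mem_toFinset, List.mem_inits] at hx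
  exact hx.length_le.trans (hL.1 ℓ hℓ).le

/-- The names of the vertices of `G_m`. -/
noncomputable def vertexName {m : ℕ} {L : Finset (List Bool)} : GVertex m L → ℕ
  | Sum.inl (i, x) => 2 * Nat.pair i (Nat.pair (treeDepth m - x.1.length) (bitValue x.1))
  | Sum.inr v => subdivName v.1.1.1 v.1.1.2 (bitValue v.2.1.1) (bitValue v.2.2.1)

/-- Parity separates tree nodes from subdivision vertices. A bit string is determined by its length
and value, and the length is recovered from the height because it is at most the depth. -/
theorem vertexName_injective {m : ℕ} {L : Finset (List Bool)} (hL : IsLeafChoice m L) :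
    Function.Injective (vertexName (m := m) (L := L)) := by
  have hb : ∀ x y : List Bool, x.length = y.length → bitValue x = bitValue y → x = y := by
    intro x y h1 h2
    rw [← bitString_bitValue x, ← bitString_bitValue y, h1, h2]
  rintro (⟨i, x⟩ | ⟨⟨⟨i, j⟩, hij⟩, ℓ₁, ℓ₂⟩) (⟨i', x'⟩ | ⟨⟨⟨i', j'⟩, hij'⟩, ℓ₁', ℓ₂'⟩) h
  · simp only [vertexName, Nat.mul_right_inj (two_ne_zero), Nat.pair_eq_pair] at h
    have h1 := length_treeNode_le hL x
    have h2 := length_treeNode_le hL x'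
    have h3 : x = x' := Subtype.ext (hb _ _ (by omega) h.2.2)
    have h4 : i = i' := Fin.ext h.1
    rw [h3, h4]
  · simp only [vertexName, subdivName] at h
    omega
  · simp only [vertexName, subdivName] at h
    omega
  · simp only [vertexName, subdivName, add_left_inj, Nat.mul_right_inj (two_ne_zero),
      Nat.pair_eq_pair] at h
    obtain ⟨⟨h1, h2⟩, h3, h4⟩ := h
    have e1 : i = i' := Fin.ext h1
    have e2 : j = j' := Fin.ext h2
    have e3 : ℓ₁ = ℓ₁' := Subtype.ext (hb _ _ (by rw [hL.1 _ ℓ₁.2, hL.1 _ ℓ₁'.2]) h3)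
    have e4 : ℓ₂ = ℓ₂' := Subtype.ext (hb _ _ (by rw [hL.1 _ ℓ₂.2, hL.1 _ ℓ₂'.2]) h4)
    subst e1 e2 e3 e4
    rfl

/-- The ancestor at height `s` of the leaf with number `c` has number `c / 2 ^ s` on its level,
which is what `nodeName` stores. -/
theorem image_rootLeafPath {m : ℕ} {L : Finset (List Bool)} (i : Fin m) (ℓ : L) {c : ℕ}
    (hc : c < 2 ^ treeDepth m) (hℓ : ℓ.1 = bitString (treeDepth m) c) :
    (rootLeafPath i ℓ).image (fun x => (vertexName x, true)) =
      (pathList (treeDepth m) i c).toFinset := by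
  have hdiv : ∀ s ≤ treeDepth m, c / 2 ^ s < 2 ^ (treeDepth m - s) := by
    intro s hs
    rw [Nat.div_lt_iff_lt_mul (by positivity), ← pow_add, Nat.sub_add_cancel hs]
    exact hc
  ext ⟨k, b⟩
  simp only [rootLeafPath, Finset.mem_image, Finset.mem_filter, Finset.mem_univ, true_and,
    pathList, List.mem_toFinset, List.mem_map, List.mem_range]
  constructor
  · rintro ⟨_, ⟨x, hx, rfl⟩, h⟩
    rw [hℓ, prefix_bitString_iff] at hx
    obtain ⟨s, hs, hx⟩ := hx
    refine ⟨s, by omega, ?_⟩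
    rw [← h, vertexName, hx, length_bitString, bitValue_bitString (hdiv s hs), Nat.sub_sub_self hs,
      nodeName]
  · rintro ⟨s, hs, h⟩
    have hpre : bitString (treeDepth m - s) (c / 2 ^ s) <+: ℓ.1 := by
      rw [hℓ, prefix_bitString_iff]
      exact ⟨s, by omega, rfl⟩
    refine ⟨_, ⟨⟨bitString (treeDepth m - s) (c / 2 ^ s), ?_⟩, hpre, rfl⟩, ?_⟩
    · exact Finset.mem_biUnion.2 ⟨ℓ.1, ℓ.2, by simpa using hpre⟩
    · rw [← h, vertexName, length_bitString, bitValue_bitString (hdiv s (by omega)),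
        Nat.sub_sub_self (by omega), nodeName]

theorem image_clauseVars {m : ℕ} {L : Finset (List Bool)} (v : SubdivVertex m L) {c₁ c₂ : ℕ}
    (h₁ : c₁ < 2 ^ treeDepth m) (h₂ : c₂ < 2 ^ treeDepth m)
    (e₁ : v.2.1.1 = bitString (treeDepth m) c₁) (e₂ : v.2.2.1 = bitString (treeDepth m) c₂) :
    ((clauseVars v).image fun x => (x, true)).image (fun l => (vertexName l.1, l.2)) =
      (clauseList (treeDepth m) v.1.1.1 v.1.1.2 c₁ c₂).toFinset := by
  rw [Finset.image_image]
  change (clauseVars v).image (fun x => (vertexName x, true)) = _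
  rw [clauseVars, Finset.image_union, Finset.image_union, image_rootLeafPath _ _ h₁ e₁,
    image_rootLeafPath _ _ h₂ e₂, clauseList, List.toFinset_append, List.toFinset_append,
    Finset.union_assoc]
  congr 2
  simp [vertexName, e₁, e₂, bitValue_bitString h₁, bitValue_bitString h₂]

theorem toCNF_phiList (m : ℕ) :
    (phiList m).toCNF = (phiG m (firstLeaves m)).rename vertexName := by
  have hb := numLeaves_le_two_pow m
  ext C
  simp only [CNFList.toCNF, List.mem_toFinset, List.mem_map, CNF.rename, phiG, Finset.image_image,
    Finset.mem_image, Finset.mem_univ, true_and, Function.comp]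
  constructor
  · rintro ⟨D, hD, rfl⟩
    obtain ⟨i, hi, j, hj, hij, c₁, h₁, c₂, h₂, rfl⟩ := mem_phiList.1 hD
    refine ⟨⟨⟨(⟨i, hi⟩, ⟨j, hj⟩), hij⟩,
      ⟨bitString (treeDepth m) c₁, Finset.mem_image_of_mem _ (Finset.mem_range.2 h₁)⟩,
      ⟨bitString (treeDepth m) c₂, Finset.mem_image_of_mem _ (Finset.mem_range.2 h₂)⟩⟩, ?_⟩
    have := image_clauseVars (m := m) (L := firstLeaves m) ⟨⟨(⟨i, hi⟩, ⟨j, hj⟩), hij⟩,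
      ⟨bitString (treeDepth m) c₁, Finset.mem_image_of_mem _ (Finset.mem_range.2 h₁)⟩,
      ⟨bitString (treeDepth m) c₂, Finset.mem_image_of_mem _ (Finset.mem_range.2 h₂)⟩⟩
      (h₁.trans_le hb) (h₂.trans_le hb) rfl rfl
    rw [Finset.image_image] at this
    exact this
  · rintro ⟨v, rfl⟩
    obtain ⟨c₁, h₁, e₁⟩ := Finset.mem_image.1 v.2.1.2
    obtain ⟨c₂, h₂, e₂⟩ := Finset.mem_image.1 v.2.2.2
    rw [Finset.mem_range] at h₁ h₂
    refine ⟨clauseList (treeDepth m) v.1.1.1 v.1.1.2 c₁ c₂, mem_phiList.2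
      ⟨_, v.1.1.1.2, _, v.1.1.2.2, v.1.2, c₁, h₁, c₂, h₂, rfl⟩, ?_⟩
    rw [← image_clauseVars v (h₁.trans_le hb) (h₂.trans_le hb) e₁.symm e₂.symm,
      Finset.image_image]

theorem exists_polyTimeProduced : ∃ (L : ℕ → Finset (List Bool)) (f : ℕ → CNFList),
    (∀ m, IsLeafChoice m (L m)) ∧ PolyTimeProduced f ∧
      ∀ m, ∃ e : GVertex m (L m) ↪ ℕ, (f m).toCNF = (phiG m (L m)).rename e :=
  ⟨firstLeaves, phiList, isLeafChoice_firstLeaves, polyTimeProduced_phiList, fun m =>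
    ⟨⟨vertexName, vertexName_injective (isLeafChoice_firstLeaves m)⟩, toCNF_phiList m⟩⟩

/-! ### Counting lemmas -/

theorem List.card_filter_get_eq_countP {α : Type*} (p : α → Prop) [DecidablePred p] (l : List α) :
    (Finset.univ.filter fun i : Fin l.length => p (l.get i)).card = l.countP p := by
  induction l with
  | nil => simp
  | cons a l ih =>
    have := Fin.card_filter_univ_succ (n := l.length) (fun i => p ((a :: l).get i))
    refine this.trans ?_
    simp only [List.get_cons_zero, List.countP_cons]
    split_ifs <;> simp_all

/-- If the sets `I u` and `J w` have at most `d` elements and every point lies in few of the sets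
`J w`, then some set separates a large part of the pairs. -/
theorem exists_separating_finset {ι U W : Type*} [Fintype ι] [DecidableEq ι] [Fintype U]
    [Fintype W] (I : U → Finset ι) (J : W → Finset ι) {d B : ℕ} (hI : ∀ u, (I u).card ≤ d)
    (hJ : ∀ w, (J w).card ≤ d) (hB : ∀ i, (Finset.univ.filter fun w => i ∈ J w).card ≤ B)
    (hd : 2 * d * B ≤ Fintype.card W) :
    ∃ A : Finset ι, Fintype.card U * Fintype.card W ≤ 2 * 4 ^ d *
      (Finset.univ.filter fun p : U × W => I p.1 ⊆ A ∧ Disjoint (J p.2) A).card := by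
  classical
  -- Each of the at most `d` points of `I u` lies in at most `B` sets `J w`; thus at most half of
  -- the `w` are lost.
  have hmeet : ∀ u, (Finset.univ.filter fun w => ¬ Disjoint (I u) (J w)).card ≤ d * B := by
    intro u
    have hsub : (Finset.univ.filter fun w => ¬ Disjoint (I u) (J w)) ⊆
        (I u).biUnion fun i => Finset.univ.filter fun w => i ∈ J w := by
      intro w hw
      simp only [Finset.mem_filter, Finset.mem_univ, true_and, Finset.not_disjoint_iff] at hw
      simpa using hw
    exact (Finset.card_le_card hsub).trans
      ((Finset.card_biUnion_le_card_mul _ _ B fun i _ => hB i).trans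
      (Nat.mul_le_mul_right _ (hI u)))
  have hdisj : ∀ u, Fintype.card W ≤
      2 * (Finset.univ.filter fun w => Disjoint (I u) (J w)).card := by
    intro u
    have h1 := Finset.card_filter_add_card_filter_not (s := (Finset.univ : Finset W))
      (fun w => Disjoint (I u) (J w))
    have h2 := hmeet u
    rw [Finset.card_univ] at h1
    have h3 : 2 * d * B = 2 * (d * B) := by ring
    omega
  -- The good sets form the interval from `I u` to the complement of `J w`, which leaves all but at
  -- most `2 * d` points free: a fraction of at least `4^(-d)` of all sets.
  have hcount : ∀ u w, Disjoint (I u) (J w) → 2 ^ Fintype.card ι ≤ 4 ^ d *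
      (Finset.univ.filter fun A : Finset ι => I u ⊆ A ∧ Disjoint (J w) A).card := by
    intro u w h
    have h1 : (Finset.univ.filter fun A : Finset ι => I u ⊆ A ∧ Disjoint (J w) A)
        = Finset.Icc (I u) (J w)ᶜ := by
      ext A
      simp only [Finset.mem_filter, Finset.mem_univ, true_and, Finset.mem_Icc]
      rw [disjoint_comm, ← Finset.subset_compl_iff_disjoint_right]
    have hIJ : I u ⊆ (J w)ᶜ := Finset.subset_compl_iff_disjoint_right.2 h
    rw [h1, Finset.card_Icc_finset hIJ, Finset.card_compl, show 4 ^ d = 2 ^ (2 * d) by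
      rw [pow_mul]; norm_num, ← pow_add]
    have := hI u
    have := hJ w
    exact Nat.pow_le_pow_right (by norm_num) (by omega)
  -- Averaging over all `A`; some `A` then does at least as well as the mean.
  have hsum : ∑ A : Finset ι, Fintype.card U * Fintype.card W ≤ ∑ A : Finset ι, 2 * 4 ^ d *
      (Finset.univ.filter fun p : U × W => I p.1 ⊆ A ∧ Disjoint (J p.2) A).card := by
    have hswap : ∑ A : Finset ι,
        (Finset.univ.filter fun p : U × W => I p.1 ⊆ A ∧ Disjoint (J p.2) A).card =
        ∑ u, ∑ w, (Finset.univ.filter fun A : Finset ι => I u ⊆ A ∧ Disjoint (J w) A).card := by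
      simp only [Finset.card_filter]
      rw [Finset.sum_comm, Fintype.sum_prod_type]
    rw [Finset.sum_const, Finset.card_univ, Fintype.card_finset, smul_eq_mul, ← Finset.mul_sum,
      hswap]
    calc 2 ^ Fintype.card ι * (Fintype.card U * Fintype.card W)
        = ∑ u : U, 2 ^ Fintype.card ι * Fintype.card W := by
          rw [Finset.sum_const, Finset.card_univ, smul_eq_mul]; ring
      _ ≤ ∑ u : U, 2 ^ Fintype.card ι *
            (2 * (Finset.univ.filter fun w => Disjoint (I u) (J w)).card) :=
          Finset.sum_le_sum fun u _ => Nat.mul_le_mul_left _ (hdisj u)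
      _ = ∑ u : U, 2 * ∑ w ∈ Finset.univ.filter fun w => Disjoint (I u) (J w),
            2 ^ Fintype.card ι := by
          refine Finset.sum_congr rfl fun u _ => ?_
          rw [Finset.sum_const, smul_eq_mul]; ring
      _ ≤ ∑ u : U, 2 * ∑ w ∈ Finset.univ.filter fun w => Disjoint (I u) (J w), 4 ^ d *
            (Finset.univ.filter fun A : Finset ι => I u ⊆ A ∧ Disjoint (J w) A).card := by
          refine Finset.sum_le_sum fun u _ =>
            Nat.mul_le_mul_left _ (Finset.sum_le_sum fun w hw => ?_)
          exact hcount u w (Finset.mem_filter.1 hw).2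
      _ ≤ ∑ u : U, 2 * ∑ w, 4 ^ d *
            (Finset.univ.filter fun A : Finset ι => I u ⊆ A ∧ Disjoint (J w) A).card :=
          Finset.sum_le_sum fun u _ => Nat.mul_le_mul_left _
            (Finset.sum_le_sum_of_subset (Finset.filter_subset _ _))
      _ = _ := by
          rw [Finset.mul_sum]
          refine Finset.sum_congr rfl fun u _ => ?_
          rw [← Finset.mul_sum]; ring
  obtain ⟨A, -, hA⟩ := Finset.exists_le_of_sum_le (Finset.univ_nonempty) hsum
  exact ⟨A, hA⟩

/-- A set of ternary words such that, on every fibre of the restriction to the complement of `G`,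
each coordinate in `G` avoids one of the values `0` and `1`. -/
theorem card_le_of_avoids {U : Type*} [Fintype U] [DecidableEq U] (F : Finset (U → Fin 3))
    (G : Finset U) (h : ∀ x ∈ F, ∀ x' ∈ F, (∀ u ∉ G, x u = x' u) → ∀ u ∈ G, x u = 0 → x' u ≠ 1) :
    F.card ≤ ∏ u, if u ∈ G then 2 else 3 := by
  classical
  let f : (U → Fin 3) → U → Fin 3 := fun x u => if u ∈ G then 0 else x u
  have hfib : ∀ y ∈ F.image f, (F.filter fun x => f x = y).card ≤ ∏ u, if u ∈ G then 2 else 1 := by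
    intro y _
    have hag : ∀ x ∈ F.filter fun x => f x = y, ∀ u ∉ G, x u = y u := by
      intro x hx u hu
      rw [← (Finset.mem_filter.1 hx).2]
      simp [f, hu]
    -- On a fibre, either some word takes the value `0` at `u`, and then `1` is forbidden there, or
    -- `0` itself never occurs.
    have hex : ∀ u, ∃ v : Fin 3, u ∈ G → ∀ x ∈ F.filter fun x => f x = y, x u ≠ v := by
      intro u
      by_cases h0 : ∃ x ∈ F.filter fun x => f x = y, x u = 0
      · obtain ⟨x, hx, hx0⟩ := h0
        refine ⟨1, fun hu x' hx' => ?_⟩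
        exact h x (Finset.mem_filter.1 hx).1 x' (Finset.mem_filter.1 hx').1
          (fun v hv => (hag x hx v hv).trans (hag x' hx' v hv).symm) u hu hx0
      · push Not at h0
        exact ⟨0, fun _ x hx => h0 x hx⟩
    choose v hv using hex
    have hsub : (F.filter fun x => f x = y) ⊆
        Fintype.piFinset fun u => if u ∈ G then Finset.univ.erase (v u) else {y u} := by
      intro x hx
      rw [Fintype.mem_piFinset]
      intro u
      split_ifs with hu
      · exact Finset.mem_erase.2 ⟨hv u hu x hx, Finset.mem_univ _⟩
      · exact Finset.mem_singleton.2 (hag x hx u hu)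
    refine (Finset.card_le_card hsub).trans (le_of_eq ?_)
    rw [Fintype.card_piFinset]
    refine Finset.prod_congr rfl fun u _ => ?_
    split_ifs <;> simp
  have himg : (F.image f).card ≤ ∏ u, if u ∈ G then 1 else 3 := by
    have hsub : F.image f ⊆ Fintype.piFinset fun u => if u ∈ G then {0} else Finset.univ := by
      intro y hy
      obtain ⟨x, -, rfl⟩ := Finset.mem_image.1 hy
      rw [Fintype.mem_piFinset]
      intro u
      by_cases hu : u ∈ G <;> simp [f, hu]
    refine (Finset.card_le_card hsub).trans (le_of_eq ?_)
    rw [Fintype.card_piFinset]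
    refine Finset.prod_congr rfl fun u _ => ?_
    split_ifs <;> simp
  calc F.card ≤ (∏ u, if u ∈ G then 2 else 1) * (F.image f).card :=
        Finset.card_le_mul_card_image F _ hfib
    _ ≤ (∏ u, if u ∈ G then 2 else 1) * ∏ u, if u ∈ G then 1 else 3 :=
        Nat.mul_le_mul_left _ himg
    _ = _ := by
        rw [← Finset.prod_mul_distrib]
        refine Finset.prod_congr rfl fun u _ => ?_
        split_ifs <;> simp

/-- Enlarging the sum from injections to all maps makes it factor over `u`. The factor `3 |W| - g
u`, with `g u` the number of `w` paired with `u` in `G`, is then bounded by `1 - t ≤ exp (-t)`. -/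
theorem sum_embedding_prod_le {U W : Type*} [Fintype U] [Fintype W] [DecidableEq U]
    [DecidableEq W] [Nonempty W] (G : Finset (U × W)) :
    ((∑ π : U ↪ W, ∏ u, if (u, π u) ∈ G then 2 else 3 : ℕ) : ℝ) ≤
      (3 * Fintype.card W : ℝ) ^ Fintype.card U * Real.exp (-(G.card / (3 * Fintype.card W))) := by
  classical
  have hq : (0 : ℝ) < 3 * Fintype.card W := by
    have : 0 < Fintype.card W := Fintype.card_pos
    positivity
  let g : U → ℕ := fun u => (Finset.univ.filter fun w => (u, w) ∈ G).card
  have hg : ∑ u, g u = G.card := by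
    simp only [g, Finset.card_filter]
    rw [← Fintype.sum_prod_type (f := fun p : U × W => if p ∈ G then 1 else 0),
      ← Finset.card_filter]
    simp
  have h1 : (∑ π : U ↪ W, ∏ u, if (u, π u) ∈ G then 2 else 3 : ℕ) ≤
      ∑ π : U → W, ∏ u, if (u, π u) ∈ G then 2 else 3 := by
    have := Finset.sum_map (Finset.univ : Finset (U ↪ W)) ⟨fun π => (π : U → W),
      DFunLike.coe_injective⟩ (fun π => ∏ u, if (u, π u) ∈ G then 2 else 3)
    exact this.symm.le.trans (Finset.sum_le_sum_of_subset (Finset.subset_univ _))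
  have h2 : (∑ π : U → W, ∏ u, if (u, π u) ∈ G then 2 else 3 : ℕ) =
      ∏ u, ∑ w, if (u, w) ∈ G then 2 else 3 := by
    rw [Finset.prod_univ_sum, Fintype.piFinset_univ]
  have h3 : ∀ u, ((∑ w, if (u, w) ∈ G then 2 else 3 : ℕ) : ℝ) ≤
      3 * Fintype.card W * Real.exp (-(g u / (3 * Fintype.card W))) := by
    intro u
    have hs : (∑ w, if (u, w) ∈ G then 2 else 3 : ℕ) + g u = 3 * Fintype.card W := by
      simp only [g, Finset.card_filter]
      rw [← Finset.sum_add_distrib, mul_comm, ← smul_eq_mul, ← Finset.card_univ,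
        ← Finset.sum_const]
      refine Finset.sum_congr rfl fun w _ => ?_
      split_ifs <;> rfl
    have hs' : ((∑ w, if (u, w) ∈ G then 2 else 3 : ℕ) : ℝ) = 3 * Fintype.card W - g u := by
      rw [eq_sub_iff_add_eq]
      exact_mod_cast hs
    have he := Real.add_one_le_exp (-(g u / (3 * Fintype.card W : ℝ)))
    calc ((∑ w, if (u, w) ∈ G then 2 else 3 : ℕ) : ℝ)
        = 3 * Fintype.card W * (-(g u / (3 * Fintype.card W : ℝ)) + 1) := by
          rw [hs']; field_simp; ring
      _ ≤ _ := by gcongr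
  calc ((∑ π : U ↪ W, ∏ u, if (u, π u) ∈ G then 2 else 3 : ℕ) : ℝ)
      ≤ ((∏ u, ∑ w, if (u, w) ∈ G then 2 else 3 : ℕ) : ℝ) := by
        exact_mod_cast h1.trans h2.le
    _ = ∏ u, ((∑ w, if (u, w) ∈ G then 2 else 3 : ℕ) : ℝ) := by push_cast; rfl
    _ ≤ ∏ u, 3 * Fintype.card W * Real.exp (-(g u / (3 * Fintype.card W))) :=
        Finset.prod_le_prod (fun u _ => by positivity) fun u _ => h3 u
    _ = _ := by
        rw [Finset.prod_mul_distrib, Finset.prod_const, Finset.card_univ, ← Real.exp_sum,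
          Finset.sum_neg_distrib, ← Finset.sum_div, ← hg]
        push_cast
        rfl

/-- By Bernoulli, `(1 - k / q) ^ k ≥ 1 - k ^ 2 / q ≥ 1 / 2`: at least half of all maps are
injective. -/
theorem pow_le_two_mul_descFactorial {k q : ℕ} (h : 2 * k ^ 2 ≤ q) :
    q ^ k ≤ 2 * q.descFactorial k := by
  rcases Nat.eq_zero_or_pos k with rfl | hk
  · simp
  have hkq : k ≤ q := by nlinarith
  have h1 := Nat.pow_sub_le_descFactorial q k
  have hq : (0 : ℝ) < q := by exact_mod_cast (by omega : 0 < q)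
  have h2 : (q : ℝ) ^ k ≤ 2 * ((q + 1 - k : ℕ) : ℝ) ^ k := by
    have hb := one_add_mul_le_pow (a := -(k / q : ℝ)) (by
      have : (k / q : ℝ) ≤ 1 := (div_le_one hq).2 (by exact_mod_cast hkq)
      linarith) k
    have h3 : (1 / 2 : ℝ) ≤ 1 + k * -(k / q : ℝ) := by
      have : (k : ℝ) * (k / q) ≤ 1 / 2 := by
        rw [← mul_div_assoc, div_le_iff₀ hq]
        have : (2 * k ^ 2 : ℝ) ≤ q := by exact_mod_cast h
        nlinarith
      linarith
    calc (q : ℝ) ^ k = 2 * ((1 / 2) * q ^ k) := by ring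
      _ ≤ 2 * ((1 + -(k / q : ℝ)) ^ k * q ^ k) := by gcongr; linarith
      _ = 2 * ((q : ℝ) - k) ^ k := by
          rw [← mul_pow]
          congr 2
          field_simp
          ring
      _ ≤ _ := by
          gcongr
          · simpa using hkq
          · rw [Nat.cast_sub (by omega)]
            push_cast
            linarith
  have h4 : q ^ k ≤ 2 * (q + 1 - k) ^ k := by exact_mod_cast h2
  omega

/-! ### Decomposition of paths of branching programs into segments -/

namespace NBP

variable {V : Type}

theorem IsPath.append {Z : NBP V} {P Q : List Z.Edge} {u v w : Z.Vertex} (hP : Z.IsPath u P v)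
    (hQ : Z.IsPath v Q w) : Z.IsPath u (P ++ Q) w := by
  induction P generalizing u with
  | nil => exact (show u = v from hP) ▸ hQ
  | cons e P ih => exact ⟨hP.1, ih hP.2⟩

theorem labels_append (Z : NBP V) (P Q : List Z.Edge) :
    Z.labels (P ++ Q) = Z.labels P ++ Z.labels Q := by
  simp [labels]

theorem IsPath.reflTransGen {Z : NBP V} {P : List Z.Edge} {u v : Z.Vertex} (h : Z.IsPath u P v) :
    Relation.ReflTransGen (fun u w => ∃ e, Z.src e = u ∧ Z.tgt e = w) u v := by
  induction P generalizing u with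
  | nil => exact (show u = v from h) ▸ .refl
  | cons e P ih => exact .head ⟨e, h.1, rfl⟩ (ih h.2)

theorem IsPath.eq_nil {Z : NBP V} {P : List Z.Edge} {u : Z.Vertex} (h : Z.IsPath u P u) :
    P = [] := by
  cases P with
  | nil => rfl
  | cons e P =>
    exact absurd (Relation.TransGen.head' ⟨e, h.1, rfl⟩ h.2.reflTransGen) (Z.acyclic u)

/-- All literals on the list of edges are true under `a`. -/
def Consistent (Z : NBP V) (a : V → Bool) (P : List Z.Edge) : Prop := ∀ l ∈ Z.labels P, a l.1 = l.2

theorem Consistent.append {Z : NBP V} {a : V → Bool} {P Q : List Z.Edge} (hP : Z.Consistent a P)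
    (hQ : Z.Consistent a Q) : Z.Consistent a (P ++ Q) := by
  intro l hl
  rw [labels_append, List.mem_append] at hl
  exact hl.elim (hP l) (hQ l)

theorem accepts_of_consistent {Z : NBP V} {a : V → Bool} {P : List Z.Edge}
    (hP : Z.IsPath Z.source P Z.sink) (h : Z.Consistent a P) : Z.Accepts a := by
  refine ⟨P, ⟨hP, fun x hx => ?_⟩, h⟩
  have h1 := h _ hx.1
  have h2 := h _ hx.2
  simp_all

/-- A segment from one vertex to another one: either all paths between these vertices (`none`), or
the edges between them with a given label. -/
abbrev Segment (Z : NBP V) : Type := Z.Vertex × Z.Vertex × Option (Option (Literal V))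

/-- The variables on a segment. -/
def segmentVars (Z : NBP V) : Z.Segment → Set V
  | (u, v, none) => {x | ∃ P, Z.IsPath u P v ∧ x ∈ (Z.labels P).map Prod.fst}
  | (_, _, some none) => ∅
  | (_, _, some (some l)) => {l.1}

/-- Some path of the segment is consistent with `a`. -/
def SegmentHolds (Z : NBP V) (a : V → Bool) : Z.Segment → Prop
  | (u, v, none) => ∃ P, Z.IsPath u P v ∧ Z.Consistent a P
  | (u, v, some o) => ∃ e, Z.src e = u ∧ Z.tgt e = v ∧ Z.label e = o ∧ Z.Consistent a [e]

/-- The segments in the list follow each other from `u` to `w`. -/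
def IsChain (Z : NBP V) : Z.Vertex → List Z.Segment → Z.Vertex → Prop
  | u, [], w => u = w
  | u, s :: c, w => s.1 = u ∧ IsChain Z s.2.1 c w

theorem labels_singleton {Z : NBP V} (e : Z.Edge) : Z.labels [e] = (Z.label e).toList := by
  cases h : Z.label e <;> simp [labels, h]

theorem SegmentHolds.exists_path {Z : NBP V} {a : V → Bool} :
    ∀ {s : Z.Segment}, Z.SegmentHolds a s → ∃ P, Z.IsPath s.1 P s.2.1 ∧ Z.Consistent a P
  | (_, _, none), h => h
  | (_, _, some _), ⟨e, h₁, h₂, _, h₄⟩ => ⟨[e], ⟨h₁, h₂⟩, h₄⟩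

/-- Whether a segment holds depends only on its own variables. This permits different assignments to
be used on different segments. -/
theorem SegmentHolds.congr {Z : NBP V} {a b : V → Bool} :
    ∀ {s : Z.Segment}, Z.SegmentHolds a s → (∀ x ∈ Z.segmentVars s, a x = b x) →
      Z.SegmentHolds b s
  | (_, _, none), ⟨P, hP, h⟩, hab =>
    ⟨P, hP, fun l hl => (hab l.1 ⟨P, hP, List.mem_map_of_mem hl⟩).symm.trans (h l hl)⟩
  | (_, _, some none), ⟨e, h₁, h₂, h₃, _⟩, _ =>
    ⟨e, h₁, h₂, h₃, fun l hl => by simp [labels_singleton, h₃] at hl⟩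
  | (_, _, some (some l')), ⟨e, h₁, h₂, h₃, h₄⟩, hab =>
    ⟨e, h₁, h₂, h₃, fun l hl => by
      have h := h₄ l hl
      rw [labels_singleton, h₃] at hl
      have hl' : l = l' := by simpa using hl
      subst hl'
      rw [← h]
      exact (hab l.1 rfl).symm⟩

theorem SegmentHolds.exists_path_of_mem {Z : NBP V} {a : V → Bool} {x : V} :
    ∀ {s : Z.Segment}, Z.SegmentHolds a s → x ∈ Z.segmentVars s →
      ∃ P, Z.IsPath s.1 P s.2.1 ∧ x ∈ (Z.labels P).map Prod.fst
  | (_, _, none), _, hx => hx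
  | (_, _, some (some l)), ⟨e, h₁, h₂, h₃, _⟩, hx => by
    refine ⟨[e], ⟨h₁, h₂⟩, ?_⟩
    rw [labels_singleton, h₃]
    simpa [segmentVars] using hx

theorem IsChain.exists_path {Z : NBP V} {a : V → Bool} {c : List Z.Segment} {u w : Z.Vertex}
    (hc : Z.IsChain u c w) (h : ∀ s ∈ c, Z.SegmentHolds a s) :
    ∃ P, Z.IsPath u P w ∧ Z.Consistent a P := by
  induction c generalizing u with
  | nil => exact ⟨[], hc, fun l hl => by simp [labels] at hl⟩
  | cons s c ih =>
    obtain ⟨P, hP, hP'⟩ := (h s (by simp)).exists_path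
    obtain ⟨Q, hQ, hQ'⟩ := ih hc.2 fun s hs => h s (by simp [hs])
    exact ⟨P ++ Q, (hc.1 ▸ hP).append hQ, hP'.append hQ'⟩

open Classical in
-- In every segment that contains `x`, choose a path through `x`. The concatenation need not be
-- computational, which is why the syntactic read condition is the right one.
theorem IsChain.exists_path_count {Z : NBP V} {a : V → Bool} {c : List Z.Segment} {u w : Z.Vertex}
    (hc : Z.IsChain u c w) (h : ∀ s ∈ c, Z.SegmentHolds a s) (x : V) :
    ∃ P, Z.IsPath u P w ∧
      c.countP (fun s => x ∈ Z.segmentVars s) ≤ ((Z.labels P).map Prod.fst).count x := by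
  induction c generalizing u with
  | nil => exact ⟨[], hc, by simp⟩
  | cons s c ih =>
    obtain ⟨Q, hQ, hQ'⟩ := ih hc.2 fun s hs => h s (by simp [hs])
    by_cases hx : x ∈ Z.segmentVars s
    · obtain ⟨P, hP, hP'⟩ := (h s (by simp)).exists_path_of_mem hx
      refine ⟨P ++ Q, (hc.1 ▸ hP).append hQ, ?_⟩
      rw [labels_append, List.map_append, List.count_append, List.countP_cons]
      have := List.count_pos_iff.2 hP'
      simp only [hx, decide_true, if_true]
      omega
    · obtain ⟨P, hP, -⟩ := (h s (by simp)).exists_path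
      refine ⟨P ++ Q, (hc.1 ▸ hP).append hQ, ?_⟩
      rw [labels_append, List.map_append, List.count_append, List.countP_cons]
      simp only [hx, decide_false]
      simp only [Bool.false_eq_true, if_false]
      omega

open Classical in
theorem IsChain.countP_le {Z : NBP V} {d : ℕ} (hd : Z.IsReadTimes d) {a : V → Bool}
    {c : List Z.Segment} (hc : Z.IsChain Z.source c Z.sink) (h : ∀ s ∈ c, Z.SegmentHolds a s)
    (x : V) : c.countP (fun s => x ∈ Z.segmentVars s) ≤ d := by
  obtain ⟨P, hP, hx⟩ := hc.exists_path_count h x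
  exact hx.trans (hd P hP x)

open Classical in
/-- The number of variables from `W` on a segment. -/
noncomputable def segmentWeight (Z : NBP V) (W : Finset V) (s : Z.Segment) : ℕ :=
  (W.filter fun x => x ∈ Z.segmentVars s).card

open Classical in
theorem sum_segmentWeight (Z : NBP V) (W : Finset V) (c : List Z.Segment) :
    (c.map (Z.segmentWeight W)).sum = ∑ x ∈ W, c.countP (fun s => x ∈ Z.segmentVars s) := by
  induction c with
  | nil => simp
  | cons s c ih =>
    simp only [List.map_cons, List.sum_cons, ih, List.countP_cons, Finset.sum_add_distrib]
    rw [add_comm, segmentWeight, Finset.card_filter]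
    simp

theorem segmentWeight_edge_le (Z : NBP V) (W : Finset V) (u v : Z.Vertex) :
    ∀ o, Z.segmentWeight W (u, v, some o) ≤ 1
  | none => by simp [segmentWeight, segmentVars]
  | some l => by
    classical
    refine Finset.card_le_one.2 fun x hx y hy => ?_
    simp only [segmentVars, Set.mem_singleton_iff, Finset.mem_filter] at hx hy
    rw [hx.2, hy.2]

theorem segmentWeight_self (Z : NBP V) (W : Finset V) (u : Z.Vertex) :
    Z.segmentWeight W (u, u, none) = 0 := by
  have : Z.segmentVars (u, u, none) = ∅ := by
    ext x
    simp only [segmentVars, Set.mem_ofPred_eq, Set.mem_empty_iff_false, iff_false]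
    rintro ⟨P, hP, hx⟩
    rw [hP.eq_nil] at hx
    simp [labels] at hx
  simp [segmentWeight, this]

/-- A consistent path splits into light segments, whose number is bounded in terms of the weight of
a second chain. -/
theorem exists_chain {Z : NBP V} {a : V → Bool} (W : Finset V) {B : ℕ} (hB : 1 ≤ B) {w : Z.Vertex}
    (P : List Z.Edge) : ∀ (u v : Z.Vertex) (Q : List Z.Edge), Z.IsPath u Q v → Z.Consistent a Q →
    Z.segmentWeight W (u, v, none) ≤ B → Z.IsPath v P w → Z.Consistent a P →
    ∃ (r : ℕ) (c C : List Z.Segment), Z.IsChain u c w ∧ Z.IsChain u C w ∧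
      (∀ s ∈ c, Z.SegmentHolds a s ∧ Z.segmentWeight W s ≤ B) ∧ (∀ s ∈ C, Z.SegmentHolds a s) ∧
      c.length ≤ 2 * r + 1 ∧ r * (B + 1) ≤ (C.map (Z.segmentWeight W)).sum := by
  induction P with
  | nil =>
    intro u v Q hQ hQ' hw hP hP'
    obtain rfl : v = w := hP
    have h : Z.SegmentHolds a (u, v, none) := ⟨Q, hQ, hQ'⟩
    exact ⟨0, [(u, v, none)], [(u, v, none)], ⟨rfl, rfl⟩, ⟨rfl, rfl⟩, by simpa using ⟨h, hw⟩,
      by simpa using h, by simp, by simp⟩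
  | cons e P ih =>
    intro u v Q hQ hQ' hw hP hP'
    obtain ⟨rfl, hP⟩ := hP
    have he : Z.Consistent a [e] := fun l hl =>
      hP' l (by
        rw [← List.singleton_append, labels_append]
        exact List.mem_append_left _ hl)
    have hP'' : Z.Consistent a P := fun l hl =>
      hP' l (by
        rw [← List.singleton_append, labels_append]
        exact List.mem_append_right _ hl)
    have hQe : Z.IsPath u (Q ++ [e]) (Z.tgt e) := hQ.append ⟨rfl, rfl⟩
    -- Greedy choice: the current segment is extended as long as it stays light.
    by_cases hw' : Z.segmentWeight W (u, Z.tgt e, none) ≤ B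
    · exact ih u (Z.tgt e) (Q ++ [e]) hQe (hQ'.append he) hw' hP hP''
    · have h0 : Z.segmentWeight W (Z.tgt e, Z.tgt e, none) ≤ B := by
        simp [segmentWeight_self]
      obtain ⟨r, c, C, hc, hC, hcs, hCs, hlen, hr⟩ :=
        ih (Z.tgt e) (Z.tgt e) [] rfl (fun l hl => by simp [labels] at hl) h0 hP hP''
      -- At the first edge `e` that makes the segment heavy, `c` receives the light part and `e`
      -- separately, while `C` receives the heavy segment including `e`, of weight at least `B + 1`.
      refine ⟨r + 1, (u, Z.src e, none) :: (Z.src e, Z.tgt e, some (Z.label e)) :: c,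
        (u, Z.tgt e, none) :: C, ⟨rfl, rfl, hc⟩, ⟨rfl, hC⟩, ?_, ?_, ?_, ?_⟩
      · intro s hs
        simp only [List.mem_cons] at hs
        rcases hs with rfl | rfl | hs
        · exact ⟨⟨Q, hQ, hQ'⟩, hw⟩
        · exact ⟨⟨e, rfl, rfl, rfl, he⟩, (segmentWeight_edge_le Z W _ _ _).trans hB⟩
        · exact hcs s hs
      · intro s hs
        simp only [List.mem_cons] at hs
        rcases hs with rfl | hs
        · exact ⟨Q ++ [e], hQe, hQ'.append he⟩
        · exact hCs s hs
      · simp only [List.length_cons]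
        omega
      · simp only [List.map_cons, List.sum_cons]
        rw [Nat.succ_mul]
        omega

/-- Every accepted assignment satisfies all segments of a short chain of light segments. -/
theorem Accepts.exists_chain {Z : NBP V} [DecidableEq V] {d : ℕ} (hd : Z.IsReadTimes d)
    {a : V → Bool} (ha : Z.Accepts a) (W : Finset V) {B : ℕ} (hB : 1 ≤ B)
    (hW : W.card ≤ 2 * d * (B + 1)) :
    ∃ c : List Z.Segment, Z.IsChain Z.source c Z.sink ∧
      (∀ s ∈ c, Z.SegmentHolds a s ∧ Z.segmentWeight W s ≤ B) ∧ c.length ≤ 4 * d ^ 2 + 1 := by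
  classical
  obtain ⟨P, ⟨hP, -⟩, ha⟩ := ha
  have h0 : Z.segmentWeight W (Z.source, Z.source, none) ≤ B := by simp [segmentWeight_self]
  obtain ⟨r, c, C, hc, hC, hcs, hCs, hlen, hr⟩ := NBP.exists_chain W hB P Z.source Z.source [] rfl
    (fun l hl => by simp [labels] at hl) h0 hP ha
  refine ⟨c, hc, hcs, hlen.trans ?_⟩
  -- Double counting: every variable of `W` lies on at most `d` segments of `C`, so few of them are
  -- heavy.
  have h1 : (C.map (Z.segmentWeight W)).sum ≤ W.card * d := by
    rw [sum_segmentWeight, ← smul_eq_mul]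
    refine Finset.sum_le_card_nsmul _ _ _ fun x _ => ?_
    exact hC.countP_le (by convert hd) hCs x
  have h2 : W.card * d ≤ 2 * d ^ 2 * (B + 1) := by
    calc W.card * d ≤ 2 * d * (B + 1) * d := Nat.mul_le_mul_right _ hW
      _ = _ := by ring
  have h3 : r ≤ 2 * d ^ 2 := Nat.le_of_mul_le_mul_right (hr.trans (h1.trans h2)) (by omega)
  omega

end NBP

/-! ### The lower bound for a family of assignments given by matchings -/

/-- A family of satisfying assignments of `φ`, indexed by the injections `π` from `Fin k` into
`Fin q` and the ternary words: for the value `0` at `u` the variable `left u` is false, for the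
value `1` the variable `right (π u)` is false, and both cannot be false at the same time. -/
structure MatchingFamily {V : Type} (φ : CNF V) (k q : ℕ) where
  left : Fin k → V
  right : Fin q → V
  asg : (Fin k ↪ Fin q) → (Fin k → Fin 3) → V → Bool
  right_injective : Function.Injective right
  left_ne_right : ∀ u w, left u ≠ right w
  sat : ∀ π x, φ.Sat (asg π x)
  asg_left : ∀ π x u, x u = 0 → asg π x (left u) = false
  asg_right : ∀ π x u, x u = 1 → asg π x (right (π u)) = false
  asg_congr : ∀ π x x' y, (∀ u, x u ≠ x' u → y ≠ left u ∧ y ≠ right (π u)) →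
    asg π x y = asg π x' y
  not_sat : ∀ π x u b, (∀ y, (∀ u, y ≠ left u) → (∀ w, y ≠ right w) → b y = asg π x y) →
    b (left u) = false → b (right (π u)) = false → ¬ φ.Sat b

namespace NBP

variable {V : Type}

open Classical in
-- One chain covers few pairs `(π, x)`: two covered words that differ only on separated pairs can be
-- spliced, and a `0` against a `1` in such a pair would make `Z` accept a falsifying assignment.
theorem sum_card_segmentHolds_le {Z : NBP V} {φ : CNF V} (hφ : Z.Computes φ) {d : ℕ}
    (hd : Z.IsReadTimes d) {k q B : ℕ} (hq : 0 < q) (hB : 2 * d * B ≤ q)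
    (M : MatchingFamily φ k q) {c : List Z.Segment} (hc : Z.IsChain Z.source c Z.sink)
    {a : V → Bool} (ha : ∀ s ∈ c, Z.SegmentHolds a s)
    (hw : ∀ s ∈ c, Z.segmentWeight (Finset.univ.map ⟨M.right, M.right_injective⟩) s ≤ B) :
    ((∑ π : Fin k ↪ Fin q, (Finset.univ.filter fun x : Fin k → Fin 3 =>
      ∀ s ∈ c, Z.SegmentHolds (M.asg π x) s).card : ℕ) : ℝ) ≤
      (3 * q : ℝ) ^ k * Real.exp (-(k / (6 * 4 ^ d))) := by
  have : Nonempty (Fin q) := ⟨⟨0, hq⟩⟩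
  let S : V → Finset (Fin c.length) := fun y =>
    Finset.univ.filter fun i => y ∈ Z.segmentVars (c.get i)
  have hS : ∀ y, (S y).card ≤ d := fun y =>
    (List.card_filter_get_eq_countP _ c).trans_le (hc.countP_le hd ha y)
  have hS' : ∀ i, (Finset.univ.filter fun w => i ∈ S (M.right w)).card ≤ B := by
    intro i
    refine le_trans ?_ (hw (c.get i) (c.get_mem i))
    rw [← Finset.card_map ⟨M.right, M.right_injective⟩]
    refine Finset.card_le_card fun y hy => ?_
    obtain ⟨w, hw, rfl⟩ := Finset.mem_map.1 hy
    simp only [S, Finset.mem_filter, Finset.mem_univ, true_and] at hw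
    simpa using hw
  obtain ⟨A, hA⟩ := exists_separating_finset (fun u => S (M.left u)) (fun w => S (M.right w))
    (fun u => hS _) (fun w => hS _) hS' (by simpa using hB)
  simp only [Fintype.card_fin] at hA
  set G : Finset (Fin k × Fin q) :=
    Finset.univ.filter fun p => S (M.left p.1) ⊆ A ∧ Disjoint (S (M.right p.2)) A with hG
  have hcard : ∀ π : Fin k ↪ Fin q, (Finset.univ.filter fun x : Fin k → Fin 3 =>
      ∀ s ∈ c, Z.SegmentHolds (M.asg π x) s).card ≤ ∏ u, if (u, π u) ∈ G then 2 else 3 := by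
    intro π
    have := card_le_of_avoids (Finset.univ.filter fun x : Fin k → Fin 3 =>
      ∀ s ∈ c, Z.SegmentHolds (M.asg π x) s) (Finset.univ.filter fun u => (u, π u) ∈ G) ?_
    · simpa using this
    intro x hx x' hx' hag u hu hx0 hx1
    simp only [Finset.mem_filter, Finset.mem_univ, true_and] at hx hx' hag hu
    have hL : ∀ u, (u, π u) ∈ G → S (M.left u) ⊆ A := fun u hu => (Finset.mem_filter.1 hu).2.1
    have hR : ∀ u, (u, π u) ∈ G → Disjoint (S (M.right (π u))) A := fun u hu =>
      (Finset.mem_filter.1 hu).2.2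
    have hcongr : ∀ y, (∀ u, (u, π u) ∈ G → y ≠ M.left u ∧ y ≠ M.right (π u)) →
        M.asg π x y = M.asg π x' y := fun y hy =>
      M.asg_congr π x x' y fun u hu => hy u (by_contra fun h => hu (hag u h))
    -- the assignment that follows `x` on the segments in `A` and `x'` on the others
    let b : V → Bool := fun y =>
      -- The second alternative matters for a left variable that occurs on no segment at all: it
      -- must still get its value under `x`.
      if (∃ i ∈ A, y ∈ Z.segmentVars (c.get i)) ∨ ∃ u, (u, π u) ∈ G ∧ y = M.left u
      then M.asg π x y else M.asg π x' y
    have hb : ∀ s ∈ c, Z.SegmentHolds b s := by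
      intro s hs
      obtain ⟨i, rfl⟩ := List.mem_iff_get.1 hs
      by_cases hi : i ∈ A
      · refine (hx _ hs).congr fun y hy => ?_
        simp only [b]
        rw [if_pos (Or.inl ⟨i, hi, hy⟩)]
      · refine (hx' _ hs).congr fun y hy => ?_
        simp only [b]
        split_ifs with h
        -- Here `b` follows `x` on a segment outside `A`. Separation shows that `y` is neither
        -- variable of a separated pair, so `x` and `x'` give it the same value.
        · refine (hcongr y fun u hu => ⟨?_, ?_⟩).symm
          · rintro rfl
            exact hi (hL u hu (by simpa [S] using hy))
          · rintro rfl
            obtain ⟨j, hj, hy'⟩ | ⟨u', -, h'⟩ := h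
            · exact Finset.disjoint_left.1 (hR u hu) (by simpa [S] using hy') hj
            · exact M.left_ne_right u' _ h'.symm
        · rfl
    obtain ⟨P, hP, hP'⟩ := hc.exists_path hb
    refine M.not_sat π x u b (fun y h1 h2 => ?_) ?_ ?_
      ((hφ b).1 (accepts_of_consistent hP hP'))
    · simp only [b]
      split_ifs
      · rfl
      · exact (hcongr y fun u _ => ⟨h1 u, h2 _⟩).symm
    · simp only [b]
      rw [if_pos (Or.inr ⟨u, hu, rfl⟩)]
      exact M.asg_left π x u hx0
    · simp only [b]
      rw [if_neg ?_]
      · exact M.asg_right π x' u hx1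
      · rintro (⟨i, hi, hy⟩ | ⟨u', -, h'⟩)
        · exact Finset.disjoint_left.1 (hR u hu) (by simpa [S] using hy) hi
        · exact M.left_ne_right u' _ h'.symm
  have hsum : (∑ π : Fin k ↪ Fin q, (Finset.univ.filter fun x : Fin k → Fin 3 =>
      ∀ s ∈ c, Z.SegmentHolds (M.asg π x) s).card) ≤
      ∑ π : Fin k ↪ Fin q, ∏ u, if (u, π u) ∈ G then 2 else 3 :=
    Finset.sum_le_sum fun π _ => hcard π
  have hmain := sum_embedding_prod_le G
  simp only [Fintype.card_fin] at hmain
  refine (Nat.cast_le.2 hsum).trans (hmain.trans ?_)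
  have hq' : (0 : ℝ) < q := by exact_mod_cast hq
  have hA' : (k * q : ℝ) ≤ 2 * 4 ^ d * G.card := by exact_mod_cast hA
  refine mul_le_mul_of_nonneg_left (Real.exp_le_exp.2 (neg_le_neg ?_)) (by positivity)
  -- From `|G| ≥ k q / (2 * 4 ^ d)` the exponent `|G| / (3 q)` is at least `k / (6 * 4 ^ d)`.
  rw [div_le_div_iff₀ (by positivity) (by positivity)]
  nlinarith

/-- Two end vertices and a kind: one of `2 |V|` literals, an unlabelled edge, or all paths between
the vertices. -/
theorem card_segment (Z : NBP V) [Fintype V] : letI := Z.vertexFintype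
    Fintype.card Z.Segment = Z.size ^ 2 * (2 * Fintype.card V + 2) := by
  let := Z.vertexFintype
  simp only [Fintype.card_prod, Fintype.card_option, Fintype.card_bool]
  rw [size]
  ring

/-- Every pair `(π, x)` is covered by some short light chain. Comparing the number of pairs, at
least `(3 q)^k / 2`, with the share of a single chain bounds the number of chains from below. -/
theorem exp_le_of_computes [Fintype V] [DecidableEq V] {Z : NBP V} {φ : CNF V}
    (hφ : Z.Computes φ) {d : ℕ} (hd : Z.IsReadTimes d) (hd1 : 1 ≤ d) {k q : ℕ} (hdq : 2 * d ≤ q)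
    (hkq : 2 * k ^ 2 ≤ q) (M : MatchingFamily φ k q) :
    Real.exp (k / (6 * 4 ^ d)) ≤
      2 * ((Z.size ^ 2 * (2 * Fintype.card V + 2) + 1 : ℕ) : ℝ) ^ (4 * d ^ 2 + 1) := by
  classical
  let := Z.vertexFintype
  set T := 4 * d ^ 2 + 1
  set B := q / (2 * d)
  have hB : 2 * d * B ≤ q := Nat.mul_div_le _ _
  have hB1 : 1 ≤ B := (Nat.one_le_div_iff (by omega)).2 hdq
  have hBq : q ≤ 2 * d * (B + 1) := (Nat.lt_mul_div_succ q (by omega)).le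
  set W := Finset.univ.map ⟨M.right, M.right_injective⟩ with hW
  have hWc : W.card = q := by simp [hW]
  -- Some assignment has to satisfy the whole chain, since otherwise the bound of `d` segments per
  -- variable is not available.
  let 𝒞 : Finset (List Z.Segment) := (List.finite_length_le Z.Segment T).toFinset.filter fun c =>
    Z.IsChain Z.source c Z.sink ∧ ∃ a, ∀ s ∈ c, Z.SegmentHolds a s ∧ Z.segmentWeight W s ≤ B
  let F : List Z.Segment → (Fin k ↪ Fin q) → Finset (Fin k → Fin 3) := fun c π =>
    Finset.univ.filter fun x => ∀ s ∈ c, Z.SegmentHolds (M.asg π x) s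
  have hcard : 𝒞.card ≤ (Z.size ^ 2 * (2 * Fintype.card V + 2) + 1) ^ T := by
    have h1 : 𝒞.card ≤ (Finset.univ : Finset (Fin T → Option Z.Segment)).card := by
      -- Lists of length at most `T` are padded with `none` to length `T`; this is the `+ 1` in the
      -- base of the bound.
      refine Finset.card_le_card_of_injOn (fun l i => l[(i : ℕ)]?) (fun c _ => by simp) ?_
      intro c hc c' hc' h
      have hl : c.length ≤ T := by simpa using (Finset.mem_filter.1 hc).1
      have hl' : c'.length ≤ T := by simpa using (Finset.mem_filter.1 hc').1
      refine List.ext_getElem? fun i => ?_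
      by_cases hi : i < T
      · exact congrFun h ⟨i, hi⟩
      · rw [List.getElem?_eq_none (by omega), List.getElem?_eq_none (by omega)]
    refine h1.trans (le_of_eq ?_)
    rw [Finset.card_univ, Fintype.card_fun, Fintype.card_fin, Fintype.card_option,
      card_segment Z]
  have hcover : ∀ π, 3 ^ k ≤ ∑ c ∈ 𝒞, (F c π).card := by
    intro π
    have h1 : (Finset.univ : Finset (Fin k → Fin 3)) ⊆ 𝒞.biUnion fun c => F c π := by
      intro x _
      obtain ⟨c, hc, hcs, hlen⟩ := ((hφ _).2 (M.sat π x)).exists_chain hd W hB1 (hWc ▸ hBq)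
      refine Finset.mem_biUnion.2 ⟨c, ?_, ?_⟩
      · refine Finset.mem_filter.2 ⟨?_, hc, _, hcs⟩
        simpa using hlen
      · simpa [F] using fun u v o hs => (hcs (u, v, o) hs).1
    have h2 := (Finset.card_le_card h1).trans Finset.card_biUnion_le
    simpa using h2
  have hq : 0 < q := by omega
  have hq' : (0 : ℝ) < q := by exact_mod_cast hq
  have htotal : q.descFactorial k * 3 ^ k ≤ ∑ c ∈ 𝒞, ∑ π, (F c π).card := by
    rw [Finset.sum_comm]
    have := Finset.card_nsmul_le_sum (Finset.univ : Finset (Fin k ↪ Fin q)) _ _ fun π _ => hcover π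
    simpa [Fintype.card_embedding_eq] using this
  have hbound : ((∑ c ∈ 𝒞, ∑ π, (F c π).card : ℕ) : ℝ) ≤
      𝒞.card * ((3 * q : ℝ) ^ k * Real.exp (-(k / (6 * 4 ^ d)))) := by
    rw [Nat.cast_sum, ← nsmul_eq_mul]
    refine Finset.sum_le_card_nsmul _ _ _ fun c hc => ?_
    obtain ⟨-, hc, a, ha⟩ := Finset.mem_filter.1 hc
    have := sum_card_segmentHolds_le hφ (d := d) (by convert hd) hq hB M hc
      (fun s hs => (ha s hs).1) fun s hs => (ha s hs).2
    refine le_trans (le_of_eq ?_) this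
    simp only [F]
    congr!
  have hfact : ((q : ℝ)) ^ k ≤ 2 * q.descFactorial k := by
    exact_mod_cast pow_le_two_mul_descFactorial hkq
  have hfinal : (3 * q : ℝ) ^ k ≤
      2 * (𝒞.card * ((3 * q : ℝ) ^ k * Real.exp (-(k / (6 * 4 ^ d))))) := by
    calc (3 * q : ℝ) ^ k = q ^ k * 3 ^ k := by rw [mul_pow]; ring
      _ ≤ 2 * q.descFactorial k * 3 ^ k := by gcongr
      _ = 2 * ((q.descFactorial k * 3 ^ k : ℕ) : ℝ) := by push_cast; ring
      _ ≤ 2 * ((∑ c ∈ 𝒞, ∑ π, (F c π).card : ℕ) : ℝ) := by gcongr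
      _ ≤ _ := by gcongr
  have hexp : Real.exp (k / (6 * 4 ^ d)) ≤ 2 * 𝒞.card := by
    rw [Real.exp_neg] at hfinal
    have he := Real.exp_pos (k / (6 * 4 ^ d) : ℝ)
    have hp : (0 : ℝ) < (3 * q : ℝ) ^ k := by positivity
    have h1 : (3 * q : ℝ) ^ k * Real.exp (k / (6 * 4 ^ d)) ≤ (3 * q : ℝ) ^ k * (2 * 𝒞.card) := by
      calc (3 * q : ℝ) ^ k * Real.exp (k / (6 * 4 ^ d))
          ≤ 2 * (𝒞.card * ((3 * q : ℝ) ^ k * (Real.exp (k / (6 * 4 ^ d)))⁻¹)) *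
            Real.exp (k / (6 * 4 ^ d)) := by gcongr
        _ = _ := by field_simp
    exact le_of_mul_le_mul_left h1 hp
  refine hexp.trans ?_
  have : (𝒞.card : ℝ) ≤ ((Z.size ^ 2 * (2 * Fintype.card V + 2) + 1 : ℕ) : ℝ) ^ T := by
    exact_mod_cast hcard
  linarith

end NBP

/-! ### The formulas `φ(G_m)` -/

theorem mem_phiG {m : ℕ} {L : Finset (List Bool)} (v : SubdivVertex m L) :
    (clauseVars v).image (fun x => (x, true)) ∈ phiG m L :=
  Finset.mem_image_of_mem _ (Finset.mem_univ v)

theorem sat_phiG_iff {m : ℕ} {L : Finset (List Bool)} (a : GVertex m L → Bool) :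
    (phiG m L).Sat a ↔ ∀ v, ∃ x ∈ clauseVars v, a x = true := by
  constructor
  · intro h v
    obtain ⟨l, hl, hal⟩ := h _ (mem_phiG v)
    obtain ⟨x, hx, rfl⟩ := Finset.mem_image.1 hl
    exact ⟨x, hx, hal⟩
  · intro h C hC
    obtain ⟨v, -, rfl⟩ := Finset.mem_image.1 hC
    obtain ⟨x, hx, hax⟩ := h v
    exact ⟨(x, true), Finset.mem_image_of_mem _ hx, hax⟩

theorem phiG_isMonotone (m : ℕ) (L : Finset (List Bool)) : (phiG m L).IsMonotone := by
  intro C hC l hl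
  obtain ⟨v, -, rfl⟩ := Finset.mem_image.1 hC
  obtain ⟨x, -, rfl⟩ := Finset.mem_image.1 hl
  rfl

theorem card_phiG_le (m : ℕ) (L : Finset (List Bool)) :
    (phiG m L).card ≤ Fintype.card (GVertex m L) := by
  refine Finset.card_image_le.trans ?_
  rw [Finset.card_univ, Fintype.card_sum (α := Fin m × TreeNode L)]
  omega

theorem IsLeafChoice.nonempty {m : ℕ} {L : Finset (List Bool)} (hL : IsLeafChoice m L)
    (hm : 0 < m) : L.Nonempty := by
  rw [← Finset.card_pos, hL.2]
  exact (le_numLeaves_iff 1 m).2 (by simpa using Nat.one_le_pow 10 m hm)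

/-- The root of the tree. -/
def rootNode {L : Finset (List Bool)} (hL : L.Nonempty) : TreeNode L :=
  ⟨[], Finset.mem_biUnion.2 ⟨hL.choose, hL.choose_spec, by simp⟩⟩

theorem le_card_GVertex {m : ℕ} {L : Finset (List Bool)} (hL : IsLeafChoice m L) :
    m ≤ Fintype.card (GVertex m L) := by
  rcases Nat.eq_zero_or_pos m with rfl | hm
  · exact Nat.zero_le _
  have := Fintype.card_le_of_injective (fun i : Fin m =>
    (Sum.inl (i, rootNode (hL.nonempty hm)) : GVertex m L)) fun i j h => by simpa using h
  simpa using this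

/-- Bounding depth and number of leaves crudely by `m` is enough, as only a polynomial relation
between `n` and `m` is needed. -/
theorem card_GVertex_le {m : ℕ} {L : Finset (List Bool)} (hL : IsLeafChoice m L) (hm : 3 ≤ m) :
    Fintype.card (GVertex m L) ≤ m ^ 5 := by
  have hp : L.card ≤ m := hL.2.trans_le (numLeaves_le m)
  have h1 : Fintype.card (TreeNode L) ≤ m * (m + 1) := by
    rw [Fintype.card_coe]
    refine (Finset.card_biUnion_le_card_mul _ _ (m + 1) fun ℓ hℓ => ?_).trans
      (Nat.mul_le_mul_right _ hp)
    refine (List.toFinset_card_le _).trans ?_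
    rw [List.length_inits, hL.1 ℓ hℓ]
    have := treeDepth_le m
    omega
  have h2 : Fintype.card (SubdivVertex m L) ≤ m * m * (m * m) := by
    rw [Fintype.card_prod, Fintype.card_prod, Fintype.card_coe]
    refine Nat.mul_le_mul ?_ (Nat.mul_le_mul hp hp)
    refine (Fintype.card_subtype_le _).trans ?_
    simp
  rw [Fintype.card_sum, Fintype.card_prod, Fintype.card_fin]
  calc m * Fintype.card (TreeNode L) + Fintype.card (SubdivVertex m L)
      ≤ m * (m * (m + 1)) + m * m * (m * m) := by gcongr
    _ ≤ m ^ 5 := by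
      have h3 : 3 * m ^ 4 ≤ m ^ 5 := by rw [pow_succ m 4, mul_comm]; gcongr
      have h4 : m ^ 2 ≤ m ^ 4 := Nat.pow_le_pow_right (by omega) (by norm_num)
      have h5 : m ^ 3 ≤ m ^ 4 := Nat.pow_le_pow_right (by omega) (by norm_num)
      calc m * (m * (m + 1)) + m * m * (m * m) = m ^ 3 + m ^ 2 + m ^ 4 := by ring
        _ ≤ _ := by omega

/-! ### Assignments from matchings between trees. -/

/-- The value of the root of the tree `i`: it is false only if the tree is matched and the ternary
word demands it. -/
def rootValue {k q : ℕ} (π : Fin k ↪ Fin q) (x : Fin k → Fin 3) (i : ℕ) : Bool :=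
  decide (∀ u : Fin k, (i = u → x u ≠ 0) ∧ (i = k + π u → x u ≠ 1))

/-- The assignment for the matching between the trees `u` and `k + π u`: the subdivision vertices
between matched trees are false, the other ones are true, and only roots of trees can be true. -/
def matchingAssignment {m : ℕ} {L : Finset (List Bool)} {k q : ℕ} (π : Fin k ↪ Fin q)
    (x : Fin k → Fin 3) : GVertex m L → Bool
  | Sum.inl (i, y) => decide (y.1 = []) && rootValue π x i
  | Sum.inr v => decide (¬ ∃ u : Fin k, (v.1.1.1 : ℕ) = u ∧ (v.1.1.2 : ℕ) = k + π u)

theorem mem_clauseVars {m : ℕ} {L : Finset (List Bool)} {v : SubdivVertex m L} {y : GVertex m L} :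
    y ∈ clauseVars v ↔ (∃ z : TreeNode L, z.1 <+: v.2.1.1 ∧ y = Sum.inl (v.1.1.1, z)) ∨
      y = Sum.inr v ∨ ∃ z : TreeNode L, z.1 <+: v.2.2.1 ∧ y = Sum.inl (v.1.1.2, z) := by
  simp only [clauseVars, rootLeafPath, Finset.mem_union, Finset.mem_image, Finset.mem_filter,
    Finset.mem_univ, true_and, Finset.mem_singleton, or_assoc, eq_comm]

/-- The assignments given by matchings between trees. -/
def phiGMatchingFamily {m : ℕ} {L : Finset (List Bool)} (hL : L.Nonempty) {k q : ℕ}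
    (hkq : k + q ≤ m) : MatchingFamily (phiG m L) k q where
  left u := Sum.inl (⟨u, by omega⟩, rootNode hL)
  right w := Sum.inl (⟨k + w, by omega⟩, rootNode hL)
  asg π x := matchingAssignment π x
  right_injective w w' h := by
    simp only [Sum.inl.injEq, Prod.mk.injEq, Fin.mk.injEq] at h
    exact Fin.ext (by omega)
  left_ne_right u w h := by
    simp only [Sum.inl.injEq, Prod.mk.injEq, Fin.mk.injEq] at h
    omega
  sat π x := by
    rw [sat_phiG_iff]
    intro v
    by_cases hv : ∃ u : Fin k, (v.1.1.1 : ℕ) = u ∧ (v.1.1.2 : ℕ) = k + π u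
    · obtain ⟨u, h1, h2⟩ := hv
      by_cases hx : x u = 0
      · refine ⟨Sum.inl (v.1.1.2, rootNode hL), mem_clauseVars.2
          (Or.inr (Or.inr ⟨_, List.nil_prefix, rfl⟩)), ?_⟩
        simp only [matchingAssignment, rootNode, decide_true, Bool.true_and, rootValue,
          decide_eq_true_eq]
        refine fun u' => ⟨fun h => by omega, fun h => ?_⟩
        have : u' = u := π.injective (Fin.ext (by omega))
        rw [this, hx]
        decide
      · refine ⟨Sum.inl (v.1.1.1, rootNode hL), mem_clauseVars.2
          (Or.inl ⟨_, List.nil_prefix, rfl⟩), ?_⟩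
        simp only [matchingAssignment, rootNode, decide_true, Bool.true_and, rootValue,
          decide_eq_true_eq]
        refine fun u' => ⟨fun h => ?_, fun h => by omega⟩
        have : u' = u := Fin.ext (by omega)
        rwa [this]
    · exact ⟨Sum.inr v, mem_clauseVars.2 (Or.inr (Or.inl rfl)), decide_eq_true hv⟩
  asg_left π x u hx := by
    simp only [matchingAssignment, rootNode, decide_true, Bool.true_and, rootValue,
      decide_eq_false_iff_not]
    exact fun h => (h u).1 rfl hx
  asg_right π x u hx := by
    simp only [matchingAssignment, rootNode, decide_true, Bool.true_and, rootValue,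
      decide_eq_false_iff_not]
    exact fun h => (h u).2 rfl hx
  asg_congr π x x' y hy := by
    match y with
    | Sum.inr v => rfl
    | Sum.inl (i, z) =>
      simp only [matchingAssignment]
      by_cases hz : z.1 = []
      · have hz' : z = rootNode hL := Subtype.ext hz
        subst hz'
        congr 1
        simp only [rootValue]
        refine decide_eq_decide.2 (forall_congr' fun u => ?_)
        by_cases hu : x u = x' u
        · rw [hu]
        · obtain ⟨h1, h2⟩ := hy u hu
          have h1' : (i : ℕ) ≠ u := fun h => h1 (by congr 2; exact Fin.ext h)
          have h2' : (i : ℕ) ≠ k + π u := fun h => h2 (by congr 2; exact Fin.ext h)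
          simp [h1', h2']
      · simp [hz]
  not_sat π x u b hb h1 h2 := by
    rw [sat_phiG_iff]
    intro h
    obtain ⟨ℓ, hℓ⟩ := id hL
    -- Below the root all nodes are false and not under the control of `b`, so a false root makes
    -- every literal of the tree false.
    have hnode : ∀ (i : Fin m) (z : TreeNode L), b (Sum.inl (i, rootNode hL)) = false →
        b (Sum.inl (i, z)) = false := by
      intro i z hi
      by_cases hz : z.1 = []
      · have hz' : z = rootNode hL := Subtype.ext hz
        rwa [hz']
      · rw [hb]
        · simp [matchingAssignment, hz]
        · intro u h
          simp only [Sum.inl.injEq, Prod.mk.injEq] at h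
          exact hz (congrArg Subtype.val h.2)
        · intro w h
          simp only [Sum.inl.injEq, Prod.mk.injEq] at h
          exact hz (congrArg Subtype.val h.2)
    have hlt : (⟨u, by omega⟩ : Fin m) < ⟨k + π u, by omega⟩ := by
      simp only [Fin.mk_lt_mk]
      omega
    obtain ⟨y, hy, hby⟩ := h ⟨⟨(⟨u, by omega⟩, ⟨k + π u, by omega⟩), hlt⟩, ⟨ℓ, hℓ⟩, ⟨ℓ, hℓ⟩⟩
    rcases mem_clauseVars.1 hy with ⟨z, -, rfl⟩ | rfl | ⟨z, -, rfl⟩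
    · rw [hnode _ _ h1] at hby
      exact absurd hby (by simp)
    · rw [hb _ (by simp) (by simp)] at hby
      exact of_decide_eq_true hby ⟨u, rfl, rfl⟩
    · rw [hnode _ _ h2] at hby
      exact absurd hby (by simp)

/-! ### The lower bound -/

theorem NBP.IsReadTimes.mono {V : Type} [DecidableEq V] {Z : NBP V} {d d' : ℕ}
    (h : Z.IsReadTimes d) (hd : d ≤ d') : Z.IsReadTimes d' :=
  fun P hP x => (h P hP x).trans hd

theorem NBP.size_pos {V : Type} (Z : NBP V) : 0 < Z.size := by
  let := Z.vertexFintype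
  exact Fintype.card_pos_iff.2 ⟨Z.source⟩

/-- The left side is at most `exp (46 * y ^ 7)` and the right side at least `exp (y ^ 24 / 12)`; `y
^ 17 > 600 > 46 * 12` decides. -/
theorem two_mul_pow_lt_exp {y : ℝ} {D k s n : ℕ} (hy1 : 1 ≤ y) (hy17 : 600 < y ^ 17)
    (hDy : (D : ℝ) ≤ y) (h4D : (4 : ℝ) ^ D ≤ y) (hkl : y ^ 25 / 2 ≤ k) (hs1 : (1 : ℝ) ≤ s)
    (hn1 : (1 : ℝ) ≤ n) (hsize : (s : ℝ) ≤ Real.exp (y ^ 5)) (hny : (n : ℝ) ≤ Real.exp (5 * y)) :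
    2 * ((s ^ 2 * (2 * n + 2) + 1 : ℕ) : ℝ) ^ (4 * D ^ 2 + 1) < Real.exp (k / (6 * 4 ^ D)) := by
  by_contra hmain
  push Not at hmain
  have hexp5 : (5 : ℝ) ≤ Real.exp 2 := by
    have := Real.quadratic_le_exp_of_nonneg (x := 2) (by norm_num)
    linarith
  have hbase : ((s ^ 2 * (2 * n + 2) + 1 : ℕ) : ℝ) ≤ Real.exp (9 * y ^ 5) := by
    push_cast
    have hy5 : y ≤ y ^ 5 := by
      calc y = y ^ 1 := (pow_one y).symm
        _ ≤ y ^ 5 := pow_le_pow_right₀ hy1 (by norm_num)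
    have hs2 : (1 : ℝ) ≤ (s : ℝ) ^ 2 := one_le_pow₀ hs1
    calc (s : ℝ) ^ 2 * (2 * n + 2) + 1 ≤ (s : ℝ) ^ 2 * (5 * n) := by nlinarith
      _ ≤ Real.exp (y ^ 5) ^ 2 * (Real.exp 2 * Real.exp (5 * y)) := by gcongr
      _ = Real.exp (2 * y ^ 5 + (2 + 5 * y)) := by
          rw [← Real.exp_nat_mul, ← Real.exp_add, ← Real.exp_add]
          norm_cast
      _ ≤ _ := Real.exp_le_exp.2 (by linarith)
  have hright : (2 : ℝ) * ((s ^ 2 * (2 * n + 2) + 1 : ℕ) : ℝ) ^ (4 * D ^ 2 + 1) ≤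
      Real.exp (46 * y ^ 7) := by
    have h2 : (2 : ℝ) ≤ Real.exp 1 := by linarith [Real.add_one_le_exp (1 : ℝ)]
    have hD2 : (4 * (D : ℝ) ^ 2 + 1) ≤ 5 * y ^ 2 := by
      have h1 : (D : ℝ) ^ 2 ≤ y ^ 2 := by gcongr
      have h2 : 1 ≤ y ^ 2 := one_le_pow₀ hy1
      linarith
    have hy7 : 1 ≤ y ^ 7 := one_le_pow₀ hy1
    calc (2 : ℝ) * ((s ^ 2 * (2 * n + 2) + 1 : ℕ) : ℝ) ^ (4 * D ^ 2 + 1)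
        ≤ Real.exp 1 * Real.exp (9 * y ^ 5) ^ (4 * D ^ 2 + 1) := by gcongr
      _ = Real.exp (1 + (4 * (D : ℝ) ^ 2 + 1) * (9 * y ^ 5)) := by
          rw [← Real.exp_nat_mul, ← Real.exp_add]
          push_cast
          rfl
      _ ≤ _ := by
          refine Real.exp_le_exp.2 ?_
          have h3 : (4 * (D : ℝ) ^ 2 + 1) * (9 * y ^ 5) ≤ 5 * y ^ 2 * (9 * y ^ 5) := by gcongr
          have h4 : 5 * y ^ 2 * (9 * y ^ 5) = 45 * y ^ 7 := by ring
          linarith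
  have hleft : y ^ 24 / 12 ≤ (k : ℝ) / (6 * 4 ^ D) := by
    rw [div_le_div_iff₀ (by norm_num) (by positivity)]
    calc y ^ 24 * (6 * 4 ^ D) ≤ y ^ 24 * (6 * y) := by gcongr
      _ = y ^ 25 / 2 * 12 := by ring
      _ ≤ k * 12 := by gcongr
  have hfinal := Real.exp_le_exp.1 (hmain.trans hright)
  have h24 : y ^ 24 = y ^ 17 * y ^ 7 := by ring
  have hy7 : 0 < y ^ 7 := by positivity
  nlinarith

theorem eventually_large : ∀ᶠ m : ℕ in Filter.atTop, Real.logb 2 m ≤ (m : ℝ) ^ (1 / 100 : ℝ) ∧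
    1 ≤ Real.logb 2 m / 20000 ∧ (600 : ℝ) < (m : ℝ) ^ (17 / 100 : ℝ) ∧ 3 ≤ m := by
  have h2 : (0 : ℝ) < Real.log 2 := Real.log_pos (by norm_num)
  have hcast := tendsto_natCast_atTop_atTop (R := ℝ)
  have e1 := hcast.eventually
    ((isLittleO_log_rpow_atTop (r := 1 / 100) (by norm_num)).bound h2)
  have e2 := hcast.eventually
    ((Real.tendsto_logb_atTop (b := 2) (by norm_num)).eventually_ge_atTop 20000)
  have e3 := hcast.eventually
    ((tendsto_rpow_atTop (y := 17 / 100) (by norm_num)).eventually_gt_atTop 600)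
  filter_upwards [e1, e2, e3, Filter.eventually_ge_atTop 3] with m h1 hm2 hm3 hm
  refine ⟨?_, by linarith, hm3, hm⟩
  rw [Real.logb, div_le_iff₀ h2]
  have := (le_abs_self _).trans h1
  rwa [Real.norm_of_nonneg (by positivity), mul_comm] at this

theorem exists_size_bound : ∃ m₀ : ℕ, ∀ m ≥ m₀, ∀ L : Finset (List Bool), IsLeafChoice m L →
    ∀ d : ℕ, (d : ℝ) ≤ Real.logb 2 (Fintype.card (GVertex m L)) / 10 ^ 5 →
    ∀ Z : NBP (GVertex m L), Z.IsReadTimes d → Z.Computes (phiG m L) →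
      (2 : ℝ) ^ ((Fintype.card (GVertex m L) : ℝ) ^ (1 / 100 : ℝ)) ≤ (Z.size : ℝ) := by
  obtain ⟨m₀, hm₀⟩ := Filter.eventually_atTop.1 eventually_large
  refine ⟨m₀, fun m hm L hL d hd Z hZ hφ => ?_⟩
  obtain ⟨hlog, hlog1, hbig, hm3⟩ := hm₀ m hm
  set n := Fintype.card (GVertex m L) with hn
  have hnm : n ≤ m ^ 5 := card_GVertex_le hL hm3
  have hmn : m ≤ n := le_card_GVertex hL
  have hm1 : (1 : ℝ) < m := by exact_mod_cast (by omega : 1 < m)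
  have hm0 : (0 : ℝ) < m := by linarith
  have hnm' : (n : ℝ) ≤ (m : ℝ) ^ 5 := by exact_mod_cast hnm
  have hn1 : (1 : ℝ) ≤ n := by exact_mod_cast (by omega : 1 ≤ n)
  have hlogn : Real.logb 2 n ≤ 5 * Real.logb 2 m := by
    have := Real.logb_le_logb_of_le (b := 2) (by norm_num) (by linarith) hnm'
    rwa [Real.logb_pow] at this
  -- all quantities are compared with powers of `y`
  set y := (m : ℝ) ^ (1 / 100 : ℝ) with hy
  have hpow : ∀ r : ℕ, (m : ℝ) ^ (r / 100 : ℝ) = y ^ r := by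
    intro r
    rw [hy, ← Real.rpow_natCast, ← Real.rpow_mul hm0.le]
    congr 1
    ring
  have hy1 : 1 ≤ y := Real.one_le_rpow hm1.le (by norm_num)
  have hy17 : 600 < y ^ 17 := by rwa [← hpow 17]
  -- the number of repetitions
  set D := max d 1 with hD
  have hD1 : 1 ≤ D := le_max_right _ _
  have hDlog : (D : ℝ) ≤ Real.logb 2 m / 20000 := by
    rw [hD, Nat.cast_max]
    -- By `n ≤ m ^ 5`, the bound `log n / 10 ^ 5` is at most `log m / 20000`.
    refine max_le (hd.trans ?_) (by exact_mod_cast hlog1)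
    rw [div_le_div_iff₀ (by norm_num) (by norm_num)]
    nlinarith
  have hDy : (D : ℝ) ≤ y := by linarith
  have h4D : (4 : ℝ) ^ D ≤ y := by
    have h1 : (4 : ℝ) ^ D = (2 : ℝ) ^ (2 * D : ℝ) := by
      rw [Real.rpow_mul (by norm_num), Real.rpow_natCast]
      norm_num
    have h2 : y = (2 : ℝ) ^ (Real.logb 2 m * (1 / 100)) := by
      rw [Real.rpow_mul (by norm_num), Real.rpow_logb (by norm_num) (by norm_num) hm0]
    rw [h1, h2]
    refine Real.rpow_le_rpow_of_exponent_le (by norm_num) ?_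
    linarith
  -- the numbers of trees on both sides of the matching
  set k := ⌊y ^ 25⌋₊ with hk
  set q := m / 2 with hq
  -- The exponent `25` makes `k` about `m^(1/4)`, small enough for `2 * k ^ 2 ≤ m / 2` and far
  -- larger than `4 ^ D ≤ m^(1/100)`.
  have hk4 : k ^ 4 ≤ m := by
    have h1 : (k : ℝ) ≤ y ^ 25 := Nat.floor_le (by positivity)
    have h2 : (k : ℝ) ^ 4 ≤ (m : ℝ) := by
      calc (k : ℝ) ^ 4 ≤ (y ^ 25) ^ 4 := by gcongr
        _ = (m : ℝ) ^ ((100 : ℕ) / 100 : ℝ) := by rw [hpow 100]; ring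
        _ = (m : ℝ) := by norm_num
    exact_mod_cast h2
  have hk3 : 3 ≤ k := by
    refine Nat.le_floor ?_
    have : y ^ 17 ≤ y ^ 25 := pow_le_pow_right₀ hy1 (by norm_num)
    push_cast
    linarith
  have hkl : y ^ 25 / 2 ≤ k := by
    have h1 := Nat.lt_floor_add_one (y ^ 25)
    have h2 : (3 : ℝ) ≤ k := by exact_mod_cast hk3
    rw [← hk] at h1
    linarith
  have hkq : 2 * k ^ 2 ≤ q := by
    have h1 : k ^ 4 = k ^ 2 * k ^ 2 := by ring
    have h2 : 9 ≤ k ^ 2 := by nlinarith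
    have h3 : 9 * k ^ 2 ≤ k ^ 4 := by rw [h1]; gcongr
    omega
  have hkk : k ≤ k ^ 2 := by nlinarith
  have hkqm : k + q ≤ m := by omega
  have hDq : 2 * D ≤ q := by
    have : D ≤ k := by
      refine Nat.le_floor (hDy.trans ?_)
      calc y = y ^ 1 := (pow_one y).symm
        _ ≤ y ^ 25 := pow_le_pow_right₀ hy1 (by norm_num)
    omega
  have hmain := NBP.exp_le_of_computes hφ (hZ.mono (le_max_left d 1)) hD1 hDq hkq
    (phiGMatchingFamily (hL.nonempty (by omega)) hkqm)
  rw [← hn, ← hD] at hmain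
  by_contra hs
  push Not at hs
  have hsize : (Z.size : ℝ) ≤ Real.exp (y ^ 5) := by
    refine hs.le.trans ?_
    rw [Real.rpow_def_of_pos (by norm_num)]
    refine Real.exp_le_exp.2 ?_
    have h1 : Real.log 2 ≤ 1 := by linarith [Real.log_two_lt_d9]
    have h2 : (n : ℝ) ^ (1 / 100 : ℝ) ≤ y ^ 5 := by
      calc (n : ℝ) ^ (1 / 100 : ℝ) ≤ ((m : ℝ) ^ 5) ^ (1 / 100 : ℝ) :=
            Real.rpow_le_rpow (by linarith) hnm' (by norm_num)
        _ = y ^ 5 := by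
            rw [hy, ← Real.rpow_natCast, ← Real.rpow_natCast, ← Real.rpow_mul hm0.le,
              ← Real.rpow_mul hm0.le, mul_comm]
    have h3 : 0 ≤ (n : ℝ) ^ (1 / 100 : ℝ) := by positivity
    nlinarith
  have hny : (n : ℝ) ≤ Real.exp (5 * y) := by
    have h1 : Real.log m ≤ y := by
      have h2 : Real.logb 2 m * Real.log 2 = Real.log m :=
        div_mul_cancel₀ _ (Real.log_pos (by norm_num)).ne'
      have h3 : Real.log 2 ≤ 1 := by linarith [Real.log_two_lt_d9]
      have h4 : 0 ≤ Real.logb 2 m := by linarith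
      nlinarith
    calc (n : ℝ) ≤ (m : ℝ) ^ 5 := hnm'
      _ = Real.exp (5 * Real.log m) := by
          rw [mul_comm, Real.exp_mul, Real.exp_log hm0]
          norm_cast
      _ ≤ _ := Real.exp_le_exp.2 (by linarith)
  have hs1 : (1 : ℝ) ≤ Z.size := by exact_mod_cast Z.size_pos
  exact (two_mul_pow_lt_exp hy1 hy17 hDy h4D hkl hs1 hn1 hsize hny).not_ge hmain

theorem mainTheorem2 :
    -- for a suitable choice of the leaf sets, the formulas are produced in polynomial time
    (∃ (L : ℕ → Finset (List Bool)) (f : ℕ → CNFList),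
      (∀ m, IsLeafChoice m (L m)) ∧ PolyTimeProduced f ∧
      ∀ m, ∃ e : GVertex m (L m) ↪ ℕ, (f m).toCNF = (phiG m (L m)).rename e) ∧
    -- they are small monotone CNFs, and the number of variables is unbounded
    (∀ (m : ℕ) (L : Finset (List Bool)), IsLeafChoice m L →
      (phiG m L).IsMonotone ∧ (phiG m L).card ≤ Fintype.card (GVertex m L) ∧
      m ≤ Fintype.card (GVertex m L)) ∧
    -- they are exponentially hard for read-`d`-times branching programs, for every choice
    -- of the leaf sets
    (∃ α β : ℝ, 1 < α ∧ 0 < β ∧ β < 1 ∧ ∃ m₀ : ℕ, ∀ m ≥ m₀,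
      ∀ L : Finset (List Bool), IsLeafChoice m L →
      ∀ d : ℕ, (d : ℝ) ≤ Real.logb 2 (Fintype.card (GVertex m L)) / 10 ^ 5 →
      ∀ Z : NBP (GVertex m L), Z.IsReadTimes d → Z.Computes (phiG m L) →
        α ^ ((Fintype.card (GVertex m L) : ℝ) ^ β) ≤ (Z.size : ℝ)) :=
  ⟨exists_polyTimeProduced,
    fun m L hL => ⟨phiG_isMonotone m L, card_phiG_le m L, le_card_GVertex hL⟩,
    2, 1 / 100, by norm_num, by norm_num, by norm_num, exists_size_bound⟩
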